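/- Let $n\ge 1$, let $H_n$ be the $(2n+1)$-dimensional Heisenberg group of real matrices $$h(x,y,z)=\begin{pmatrix}1&x&z\\0&\mathrm{Id}_n&y\\0&0&1\end{pmatrix},\qquad x,y\in\mathbb R^n \ (\text{row, resp. column vector}),\ z\in\mathbb R,$$ with Lie algebra $\mathfrak h_n$ and exponential map $\exp:\mathfrak h_n\to H_n$. Let $\Gamma\subset H_n$ be a lattice, that is, a discrete subgroup such that the Heisenberg manifold $M=H_n/\Gamma$ carries an $H_n$-invariant probability measure $\mu$. For $m_1,m_2\in M$ the connecting curves of the pair $m_1,m_2$ are the nonconstant curves $c(t)=\exp(tv)\cdot m_1$, $0\le t\le 1$, with $v\in\mathfrak h_n$ and $c(1)=m_2$. The pair $m_1,m_2$ is blockable ($m_1$ is blockable away from $m_2$) if there is a finite set $B\subset M\setminus\{m_1,m_2\}$ which meets $c([0,1])$ for every connecting curve $c$ of the pair. The pair is midpoint blockable if the set of midpoints $c(1/2)$ of its connecting curves is finite. Theorem. For every such $M$ the following claims hold. 1. A pair of points in $M$ is blockable if and only if it is midpoint blockable. 2. Every point in $M$ is blockable away from itself. 3. The set of blockable pairs is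 dense in $M\times M$ and is a countable union of closed (embedded, smooth) submanifolds of $M\times M$ of positive codimension. 4. Almost all pairs of points, with respect to $\mu\times\mu$, are not blockable. -/

import Mathlib

open MeasureTheory

open scoped ContDiff

/-- The `(2n+1)`-dimensional Heisenberg group `H_n`. Its element `⟨x, y, z⟩` stands for the real
upper triangular block matrix with rows `(1, x, z)`, `(0, 1_n, y)`, `(0, 0, 1)`; see `toMatrix`,
`toMatrix_injective`, `toMatrix_mul`. -/
@[ext]
structure HeisenbergGroup (n : ℕ) where
  x : Fin n → ℝ
  y : Fin n → ℝ
  z : ℝ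

/-- The Heisenberg Lie algebra `𝔥_n`, as a real vector space. Its element `(x, y, z)` stands for
the block matrix with rows `(0, x, z)`, `(0, 0, y)`, `(0, 0, 0)`; see `lieMatrix`. The same space
is used for the global coordinates `(x, y, z)` on `H_n`. -/
abbrev HeisenbergAlgebra (n : ℕ) : Type := (Fin n → ℝ) × (Fin n → ℝ) × ℝ

namespace HeisenbergGroup

variable {n : ℕ}

/-- Multiplication of matrices, see `toMatrix_mul`. -/
instance : Mul (HeisenbergGroup n) :=
  ⟨fun g h => ⟨g.x + h.x, g.y + h.y, g.z + h.z + g.x ⬝ᵥ h.y⟩⟩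

instance : One (HeisenbergGroup n) := ⟨⟨0, 0, 0⟩⟩

instance : Inv (HeisenbergGroup n) := ⟨fun g => ⟨-g.x, -g.y, -g.z + g.x ⬝ᵥ g.y⟩⟩

theorem mul_def (g h : HeisenbergGroup n) :
    g * h = ⟨g.x + h.x, g.y + h.y, g.z + h.z + g.x ⬝ᵥ h.y⟩ := rfl

theorem one_def : (1 : HeisenbergGroup n) = ⟨0, 0, 0⟩ := rfl

theorem inv_def (g : HeisenbergGroup n) : g⁻¹ = ⟨-g.x, -g.y, -g.z + g.x ⬝ᵥ g.y⟩ := rfl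

instance : Group (HeisenbergGroup n) :=
  Group.ofLeftAxioms
    (fun a b c => by
      simp only [mul_def, HeisenbergGroup.mk.injEq, add_dotProduct, dotProduct_add]
      exact ⟨add_assoc _ _ _, add_assoc _ _ _, by ring⟩)
    (fun a => by simp [mul_def, one_def])
    (fun a => by simp [mul_def, one_def, inv_def])

/-- The global coordinates on `H_n`. -/
def coord : HeisenbergGroup n ≃ HeisenbergAlgebra n where
  toFun g := (g.x, g.y, g.z)
  invFun v := ⟨v.1, v.2.1, v.2.2⟩
  left_inv _ := rfl
  right_inv _ := rfl

/-- The topology of `ℝ^(2n+1)`. -/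
instance : TopologicalSpace (HeisenbergGroup n) := TopologicalSpace.induced coord inferInstance

instance : MeasurableSpace (HeisenbergGroup n) := borel _

instance : BorelSpace (HeisenbergGroup n) := ⟨rfl⟩

/-- The matrix represented by an element of `H_n`. -/
def toMatrix (g : HeisenbergGroup n) : Matrix (Unit ⊕ Fin n ⊕ Unit) (Unit ⊕ Fin n ⊕ Unit) ℝ :=
  Matrix.of fun
    | .inl _, .inl _ => 1
    | .inl _, .inr (.inl j) => g.x j
    | .inl _, .inr (.inr _) => g.z
    | .inr (.inl _), .inl _ => 0
    | .inr (.inl i), .inr (.inl j) => if i = j then 1 else 0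
    | .inr (.inl i), .inr (.inr _) => g.y i
    | .inr (.inr _), .inl _ => 0
    | .inr (.inr _), .inr (.inl _) => 0
    | .inr (.inr _), .inr (.inr _) => 1

/-- The matrix represented by an element of `𝔥_n`. -/
def lieMatrix (v : HeisenbergAlgebra n) :
    Matrix (Unit ⊕ Fin n ⊕ Unit) (Unit ⊕ Fin n ⊕ Unit) ℝ :=
  Matrix.of fun
    | .inl _, .inr (.inl j) => v.1 j
    | .inl _, .inr (.inr _) => v.2.2
    | .inr (.inl i), .inr (.inr _) => v.2.1 i
    | _, _ => 0

/-- The exponential map `𝔥_n → H_n`, that is, the matrix exponential; see `toMatrix_exp`. -/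
noncomputable def exp (v : HeisenbergAlgebra n) : HeisenbergGroup n :=
  ⟨v.1, v.2.1, v.2.2 + (v.1 ⬝ᵥ v.2.1) / 2⟩

theorem toMatrix_injective : Function.Injective (toMatrix (n := n)) := by
  intro g h e
  ext i
  · exact congrFun (congrFun e (.inl ())) (.inr (.inl i))
  · exact congrFun (congrFun e (.inr (.inl i))) (.inr (.inr ()))
  · exact congrFun (congrFun e (.inl ())) (.inr (.inr ()))

theorem toMatrix_mul (g h : HeisenbergGroup n) : toMatrix (g * h) = toMatrix g * toMatrix h := by
  ext (_ | i | _) (_ | j | _) <;>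
    simp [toMatrix, mul_def, Matrix.mul_apply, Fintype.sum_sum_type, dotProduct] <;> ring

theorem toMatrix_exp (v : HeisenbergAlgebra n) :
    toMatrix (exp v) = NormedSpace.exp (lieMatrix v) := by
  have h3 : lieMatrix v ^ 3 = 0 := by
    ext (_ | i | _) (_ | j | _) <;>
      simp [lieMatrix, pow_succ, Matrix.mul_apply, Fintype.sum_sum_type]
  rw [NormedSpace.exp_eq_tsum ℝ]
  dsimp only
  rw [tsum_eq_sum (s := Finset.range 3) (fun k hk => by
    rw [pow_eq_zero_of_le (by simpa using hk) h3, smul_zero])]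
  ext (_ | i | _) (_ | j | _) <;>
    simp [lieMatrix, toMatrix, exp, Finset.sum_range_succ, pow_succ, Matrix.mul_apply,
      Fintype.sum_sum_type, dotProduct, Matrix.one_apply, Nat.factorial] <;> ring

/-- A lattice in `H_n`: a discrete subgroup such that `H_n ⧸ Γ` carries an invariant probability
measure. -/
def IsLattice (Γ : Subgroup (HeisenbergGroup n)) : Prop :=
  DiscreteTopology Γ ∧ ∃ μ : Measure (HeisenbergGroup n ⧸ Γ),
    IsProbabilityMeasure μ ∧ SMulInvariantMeasure (HeisenbergGroup n) (HeisenbergGroup n ⧸ Γ) μ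

variable (Γ : Subgroup (HeisenbergGroup n))

/-- The connecting curves `c(t) = exp(t v) • m₁`, `0 ≤ t ≤ 1`, of the pair `m₁, m₂`. The constant
curve `v = 0`, which occurs only for `m₁ = m₂`, is not a connecting curve. (Only the values for
`0 ≤ t ≤ 1` are ever used; `c` is determined by them.) -/
def connectingCurves (m₁ m₂ : HeisenbergGroup n ⧸ Γ) : Set (ℝ → HeisenbergGroup n ⧸ Γ) :=
  {c | (∃ v : HeisenbergAlgebra n, v ≠ 0 ∧ ∀ t : ℝ, c t = exp (t • v) • m₁) ∧
    c 0 = m₁ ∧ c 1 = m₂}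

/-- A finite set `B`, containing neither `m₁` nor `m₂`, that every connecting curve meets. -/
def IsBlockingSet (m₁ m₂ : HeisenbergGroup n ⧸ Γ) (B : Set (HeisenbergGroup n ⧸ Γ)) : Prop :=
  B.Finite ∧ m₁ ∉ B ∧ m₂ ∉ B ∧
    ∀ c ∈ connectingCurves Γ m₁ m₂, ∃ t ∈ Set.Icc (0 : ℝ) 1, c t ∈ B

def IsBlockable (m₁ m₂ : HeisenbergGroup n ⧸ Γ) : Prop := ∃ B, IsBlockingSet Γ m₁ m₂ B

def IsMidpointBlockable (m₁ m₂ : HeisenbergGroup n ⧸ Γ) : Prop :=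
  {p | ∃ c ∈ connectingCurves Γ m₁ m₂, p = c (1 / 2)}.Finite

/-- The covering `ℝ^(2n+1) × ℝ^(2n+1) ≅ H_n × H_n → M × M`, where `M = H_n ⧸ Γ`. The smooth
structure of `M × M` (for discrete `Γ`) is the one that makes it a local diffeomorphism. -/
def pairCover (w : HeisenbergAlgebra n × HeisenbergAlgebra n) :
    (HeisenbergGroup n ⧸ Γ) × (HeisenbergGroup n ⧸ Γ) :=
  (QuotientGroup.mk (coord.symm w.1), QuotientGroup.mk (coord.symm w.2))

/-- `S` is a closed (embedded, smooth) submanifold of `M × M` of codimension `k`: it is closed, and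
near each of its points it is the zero set of a smooth submersion to `ℝ^k`. Smoothness and
derivatives of functions on `M × M` are those of their lifts through the covering `pairCover`. -/
def IsClosedSubmanifold (S : Set ((HeisenbergGroup n ⧸ Γ) × (HeisenbergGroup n ⧸ Γ)))
    (k : ℕ) : Prop :=
  IsClosed S ∧ ∀ p ∈ S, ∃ U : Set ((HeisenbergGroup n ⧸ Γ) × (HeisenbergGroup n ⧸ Γ)),
    IsOpen U ∧ p ∈ U ∧ ∃ F : (HeisenbergGroup n ⧸ Γ) × (HeisenbergGroup n ⧸ Γ) → (Fin k → ℝ),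
      ContDiffOn ℝ ∞ (F ∘ pairCover Γ) (pairCover Γ ⁻¹' U) ∧
      (∀ w ∈ pairCover Γ ⁻¹' U, Function.Surjective (fderiv ℝ (F ∘ pairCover Γ) w)) ∧
      S ∩ U = {q ∈ U | F q = 0}

end HeisenbergGroup

/-! Everything follows from one criterion, `isBlockable_mk_iff`. Let Λ be the image of Γ in the
abelianization ℝ²ⁿ, a full lattice, and let σ be the symplectic form scaled to be integral on Λ.
Then `g₁Γ` is blockable from `g₂Γ` exactly when `v = proj g₂ - proj g₁` is rational, that is, σ(v,
Λ) ⊆ ℚ.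

If v is rational, the numbers σ(v, w), w ∈ Λ, have a common denominator. Modulo Γ all midpoints then
have bounded coordinates in a fixed translate of a discrete set, so there are finitely many
(`isMidpointBlockable_of_mem_rationalPoints`). Midpoints, slightly modified for loops, form a
blocking set.

Conversely, suppose a finite set blocks and v ∉ Λ. Two pigeonhole arguments apply. Varying a curve
by central elements of Γ forces a rational blocking time (`exists_rational_time`). Varying it by
powers of η ∈ Γ then gives a linear equation with rational data for σ(v, proj η)
(`mem_rationalPoints_of_blocking`).

The rational vectors form a countable dense subgroup containing Λ. Blockable pairs are therefore the
preimage of a countable set under the difference map M × M → ℝ²ⁿ/Λ, and the claims on density,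
submanifolds and measure are read off from this map. -/

namespace HeisenbergGroup

/-- The abelianization `ℝ^n × ℝ^n` of `H_n`. -/
abbrev Horizontal (n : ℕ) : Type := (Fin n → ℝ) × (Fin n → ℝ)

/-! ### Exponential coordinates and one-parameter groups -/

section Coordinates

variable {n : ℕ}

/-- The projection of `H_n` onto its abelianization. -/
def proj (g : HeisenbergGroup n) : Horizontal n := (g.x, g.y)

/-- The central exponential coordinate. -/
noncomputable def height (g : HeisenbergGroup n) : ℝ := g.z - (g.x ⬝ᵥ g.y) / 2

/-- The symplectic form on the abelianization induced by commutators. -/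
def symplecticForm : Horizontal n →ₗ[ℝ] Horizontal n →ₗ[ℝ] ℝ :=
  LinearMap.mk₂ ℝ (fun v w => v.1 ⬝ᵥ w.2 - w.1 ⬝ᵥ v.2)
    (fun a b c => by simp only [Prod.fst_add, Prod.snd_add, add_dotProduct, dotProduct_add]; ring)
    (fun r a b => by
      simp only [Prod.smul_fst, Prod.smul_snd, smul_dotProduct, dotProduct_smul, smul_eq_mul]; ring)
    (fun a b c => by simp only [Prod.fst_add, Prod.snd_add, add_dotProduct, dotProduct_add]; ring)
    (fun r a b => by
      simp only [Prod.smul_fst, Prod.smul_snd, smul_dotProduct, dotProduct_smul, smul_eq_mul]; ring)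

theorem symplecticForm_apply (v w : Horizontal n) :
    symplecticForm v w = v.1 ⬝ᵥ w.2 - w.1 ⬝ᵥ v.2 := rfl

theorem symplecticForm_self (v : Horizontal n) : symplecticForm v v = 0 := by
  simp [symplecticForm_apply]

theorem symplecticForm_nondegenerate {v : Horizontal n} (h : ∀ w, symplecticForm v w = 0) :
    v = 0 := by
  ext i
  · simpa [symplecticForm_apply] using h (0, Pi.single i 1)
  · simpa [symplecticForm_apply] using h (Pi.single i 1, 0)

@[simp] theorem proj_one : proj (1 : HeisenbergGroup n) = 0 := rfl

@[simp] theorem proj_mul (g h : HeisenbergGroup n) : proj (g * h) = proj g + proj h := rfl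

@[simp] theorem proj_inv (g : HeisenbergGroup n) : proj g⁻¹ = -proj g := rfl

theorem height_mul (g h : HeisenbergGroup n) :
    height (g * h) = height g + height h + symplecticForm (proj g) (proj h) / 2 := by
  simp only [height, mul_def, symplecticForm_apply, proj, add_dotProduct, dotProduct_add]
  ring

@[simp] theorem height_inv (g : HeisenbergGroup n) : height g⁻¹ = -height g := by
  simp only [height, inv_def, neg_dotProduct, dotProduct_neg]
  ring

theorem ext_proj_height {g h : HeisenbergGroup n} (hp : proj g = proj h)
    (hh : height g = height h) : g = h := by
  have h1 : g.x = h.x := congrArg Prod.fst hp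
  have h2 : g.y = h.y := congrArg Prod.snd hp
  refine HeisenbergGroup.ext h1 h2 ?_
  simpa [height, h1, h2] using hh

/-- The logarithm of `H_n`. -/
noncomputable def log (g : HeisenbergGroup n) : HeisenbergAlgebra n := (g.x, g.y, height g)

@[simp] theorem exp_log (g : HeisenbergGroup n) : exp (log g) = g := by
  simp [exp, log, height]

@[simp] theorem log_exp (v : HeisenbergAlgebra n) : log (exp v) = v := by
  simp [exp, log, height]

/-- The point at time `t` of the one-parameter group through `g`. -/
noncomputable def rpow (g : HeisenbergGroup n) (t : ℝ) : HeisenbergGroup n := exp (t • log g)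

@[simp] theorem proj_rpow (g : HeisenbergGroup n) (t : ℝ) : proj (rpow g t) = t • proj g := rfl

@[simp] theorem height_rpow (g : HeisenbergGroup n) (t : ℝ) :
    height (rpow g t) = t * height g := by
  simp [rpow, log, height, exp]

@[simp] theorem rpow_zero (g : HeisenbergGroup n) : rpow g 0 = 1 := by
  simp [rpow, exp, one_def]

@[simp] theorem rpow_one (g : HeisenbergGroup n) : rpow g 1 = g := by
  simp [rpow]

theorem rpow_rpow (g : HeisenbergGroup n) (s t : ℝ) : rpow (rpow g s) t = rpow g (t * s) := by
  simp [rpow, mul_smul]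

theorem rpow_half_mul_self (g : HeisenbergGroup n) : rpow g (1 / 2) * rpow g (1 / 2) = g := by
  apply ext_proj_height
  · rw [proj_mul, proj_rpow, ← add_smul]; norm_num
  · simp only [height_mul, height_rpow, proj_rpow, map_smul, LinearMap.smul_apply,
      symplecticForm_self, smul_eq_mul]
    ring

theorem symplecticForm_swap (v w : Horizontal n) :
    symplecticForm w v = -symplecticForm v w := by
  simp [symplecticForm_apply]

/-- Conjugation changes the height only by a term linear in `proj a`, so it commutes with scaling.
This lets the left action by `exp (t • v)` be rewritten as right multiplication by a root. -/
theorem rpow_conj (g a : HeisenbergGroup n) (t : ℝ) :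
    rpow (g⁻¹ * a * g) t = g⁻¹ * rpow a t * g := by
  apply ext_proj_height
  · simp
  · simp only [height_mul, height_rpow, proj_rpow, map_smul, LinearMap.smul_apply, proj_mul,
      map_add, proj_inv, map_neg, LinearMap.add_apply, LinearMap.neg_apply, smul_eq_mul,
      symplecticForm_self, height_inv]
    ring

end Coordinates

/-! ### Connecting curves in terms of lattice elements -/

section Curves

variable {n : ℕ} (Γ : Subgroup (HeisenbergGroup n))

/-- Lifted to start at `g₁`, a connecting curve must end at some `g₂ * γ`, and `exp` is bijective;
so lattice elements parametrize the curves. -/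
theorem mem_connectingCurves_mk {g₁ g₂ : HeisenbergGroup n} {c : ℝ → HeisenbergGroup n ⧸ Γ} :
    c ∈ connectingCurves Γ g₁ g₂ ↔ ∃ γ ∈ Γ, g₁⁻¹ * g₂ * γ ≠ 1 ∧
      ∀ t, c t = (g₁ * rpow (g₁⁻¹ * g₂ * γ) t : HeisenbergGroup n) := by
  constructor
  · rintro ⟨⟨v, hv, hc⟩, -, h1⟩
    rw [hc, one_smul] at h1
    have h2 : g₂⁻¹ * (exp v * g₁) ∈ Γ := QuotientGroup.eq.1 h1.symm
    have h3 : g₁⁻¹ * g₂ * (g₂⁻¹ * (exp v * g₁)) = g₁⁻¹ * exp v * g₁ := by group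
    refine ⟨_, h2, ?_, fun t => ?_⟩
    · rw [h3]
      intro h
      have : exp v = 1 := by
        have : exp v = g₁ * (g₁⁻¹ * exp v * g₁) * g₁⁻¹ := by group
        rw [this, h]; group
      apply hv
      rw [← log_exp v, this]
      ext <;> simp [log, one_def, height]
    · rw [h3, rpow_conj, hc, rpow, log_exp]
      change ((exp (t • v) * g₁ : HeisenbergGroup n) : HeisenbergGroup n ⧸ Γ) = _
      congr 1
      group
  · rintro ⟨γ, hγ, hne, hc⟩
    have key : ∀ t, g₁ * rpow (g₁⁻¹ * g₂ * γ) t = rpow (g₂ * γ * g₁⁻¹) t * g₁ := by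
      intro t
      have : g₁⁻¹ * g₂ * γ = g₁⁻¹ * (g₂ * γ * g₁⁻¹) * g₁ := by group
      rw [this, rpow_conj]; group
    refine ⟨⟨log (g₂ * γ * g₁⁻¹), fun h => hne ?_, fun t => ?_⟩, ?_, ?_⟩
    · have h' := congrArg exp h
      rw [exp_log] at h'
      have h0 : exp (0 : HeisenbergAlgebra n) = 1 := by simp [exp, one_def]
      rw [h0] at h'
      have : g₁⁻¹ * g₂ * γ = g₁⁻¹ * (g₂ * γ * g₁⁻¹) * g₁ := by group
      rw [this, h']; group
    · rw [hc, key]; rfl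
    · simp [hc]
    · rw [hc, rpow_one, QuotientGroup.eq]
      have : (g₁ * (g₁⁻¹ * g₂ * γ))⁻¹ * g₂ = γ⁻¹ := by group
      rw [this]; exact Γ.inv_mem hγ

end Curves

/-! ### The base torus and the arithmetic of the lattice -/

section Torus

variable {n : ℕ} (Γ : Subgroup (HeisenbergGroup n))

/-- The image of `Γ` in the abelianization. -/
def horizontalLattice : AddSubgroup (Horizontal n) where
  carrier := proj '' (Γ : Set (HeisenbergGroup n))
  zero_mem' := ⟨1, Γ.one_mem, rfl⟩
  add_mem' := by
    rintro _ _ ⟨g, hg, rfl⟩ ⟨h, hh, rfl⟩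
    exact ⟨g * h, Γ.mul_mem hg hh, rfl⟩
  neg_mem' := by
    rintro _ ⟨g, hg, rfl⟩
    exact ⟨g⁻¹, Γ.inv_mem hg, rfl⟩

variable {Γ} in
theorem mem_horizontalLattice {v : Horizontal n} :
    v ∈ horizontalLattice Γ ↔ ∃ γ ∈ Γ, proj γ = v := Iff.rfl

variable {Γ} in
theorem proj_mem_horizontalLattice {γ : HeisenbergGroup n} (h : γ ∈ Γ) :
    proj γ ∈ horizontalLattice Γ := ⟨γ, h, rfl⟩

/-- The projection of the Heisenberg manifold onto its base torus. -/
def torusProj : HeisenbergGroup n ⧸ Γ → Horizontal n ⧸ horizontalLattice Γ :=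
  Quotient.lift (fun g => (proj g : Horizontal n ⧸ horizontalLattice Γ)) (by
    intro g h hgh
    rw [QuotientAddGroup.eq]
    exact ⟨g⁻¹ * h, QuotientGroup.leftRel_apply.1 hgh, rfl⟩)

@[simp] theorem torusProj_mk (g : HeisenbergGroup n) :
    torusProj Γ (g : HeisenbergGroup n ⧸ Γ) = (proj g : Horizontal n ⧸ horizontalLattice Γ) := rfl

theorem torusProj_smul (h : HeisenbergGroup n) (m : HeisenbergGroup n ⧸ Γ) :
    torusProj Γ (h • m) = (proj h : Horizontal n ⧸ horizontalLattice Γ) + torusProj Γ m := by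
  induction m using QuotientGroup.induction_on
  rfl

theorem continuous_coord : Continuous (coord : HeisenbergGroup n → HeisenbergAlgebra n) :=
  continuous_induced_dom

theorem continuous_coord_symm : Continuous (coord.symm : HeisenbergAlgebra n → HeisenbergGroup n) :=
  continuous_induced_rng.2 (by simpa using continuous_id)

theorem continuous_proj : Continuous (proj : HeisenbergGroup n → Horizontal n) := by
  have := continuous_coord (n := n)
  exact (continuous_fst.comp this).prodMk (continuous_fst.comp (continuous_snd.comp this))

theorem continuous_torusProj : Continuous (torusProj Γ) :=
  Continuous.quotient_lift (QuotientAddGroup.continuous_mk.comp continuous_proj) _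

theorem measurable_torusProj : Measurable (torusProj Γ) :=
  measurable_from_quotient.2
    (QuotientAddGroup.measurable_coe.comp continuous_proj.measurable)

theorem exists_proj_eq (v : Horizontal n) : ∃ g : HeisenbergGroup n, proj g = v :=
  ⟨⟨v.1, v.2, 0⟩, rfl⟩

theorem measure_preimage_torusProj_add (μ : Measure (HeisenbergGroup n ⧸ Γ))
    [SMulInvariantMeasure (HeisenbergGroup n) (HeisenbergGroup n ⧸ Γ) μ]
    (v : Horizontal n) {s : Set (Horizontal n ⧸ horizontalLattice Γ)} (hs : MeasurableSet s) :
    μ (torusProj Γ ⁻¹' ((fun x => (v : Horizontal n ⧸ horizontalLattice Γ) + x) ⁻¹' s)) =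
      μ (torusProj Γ ⁻¹' s) := by
  obtain ⟨g, rfl⟩ := exists_proj_eq v
  rw [← SMulInvariantMeasure.measure_preimage_smul (μ := μ) g (measurable_torusProj Γ hs)]
  congr 1
  ext m
  simp [torusProj_smul]

/-- Otherwise a nonzero functional vanishing on Λ descends to M and pushes μ forward to a
translation-invariant probability measure on ℝ, which cannot exist since ℝ is not compact. -/
theorem span_horizontalLattice (hΓ : IsLattice Γ) :
    Submodule.span ℝ (horizontalLattice Γ : Set (Horizontal n)) = ⊤ := by
  obtain ⟨-, μ, _, _⟩ := hΓ
  by_contra hlt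
  obtain ⟨f, hf, hle⟩ := Submodule.exists_le_ker_of_lt_top _ (lt_top_iff_ne_top.2 hlt)
  have hker : horizontalLattice Γ ≤ f.toAddMonoidHom.ker := fun v hv =>
    hle (Submodule.subset_span hv)
  set F := QuotientAddGroup.lift (horizontalLattice Γ) f.toAddMonoidHom hker with hF
  have hFm : Measurable F := measurable_from_quotient.2
    (f.continuous_of_finiteDimensional.measurable)
  have hm : Measurable (F ∘ torusProj Γ) := hFm.comp (measurable_torusProj Γ)
  have hfs : Function.Surjective f := LinearMap.surjective hf
  have hinv : (μ.map (F ∘ torusProj Γ)).IsAddLeftInvariant := by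
    refine ⟨fun r => Measure.ext fun s hs => ?_⟩
    obtain ⟨v, rfl⟩ := hfs r
    have h1 : MeasurableSet ((fun x => f v + x) ⁻¹' s) := measurable_const_add _ hs
    rw [Measure.map_apply (measurable_const_add _) hs, Measure.map_apply hm h1,
      Measure.map_apply hm hs, Set.preimage_comp, Set.preimage_comp,
      ← measure_preimage_torusProj_add Γ μ v (hFm hs)]
    congr 1
    ext m
    simp [hF]
  have hprob : IsProbabilityMeasure (μ.map (F ∘ torusProj Γ)) :=
    Measure.isProbabilityMeasure_map hm.aemeasurable
  have hpos : (μ.map (F ∘ torusProj Γ)).IsOpenPosMeasure :=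
    isOpenPosMeasure_of_addLeftInvariant_of_regular
  have := measure_univ_of_isAddLeftInvariant (μ.map (F ∘ torusProj Γ))
  rw [measure_univ] at this
  exact ENNReal.one_ne_top this

theorem eq_zero_of_forall_lattice (hspan : Submodule.span ℝ
    (horizontalLattice Γ : Set (Horizontal n)) = ⊤) (f : Horizontal n →ₗ[ℝ] ℝ)
    (h : ∀ γ ∈ Γ, f (proj γ) = 0) : f = 0 := by
  refine LinearMap.ext_on_range (v := fun γ : Γ => proj γ.1) ?_ (fun γ => h γ.1 γ.2)
  rw [← hspan]
  congr 1
  ext v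
  simp [mem_horizontalLattice]

/-- The intersection of `Γ` with the centre of `H_n`. -/
def centralLattice : AddSubgroup ℝ where
  carrier := {s | (⟨0, 0, s⟩ : HeisenbergGroup n) ∈ Γ}
  zero_mem' := Γ.one_mem
  add_mem' := by
    intro a b ha hb
    simpa [mul_def] using Γ.mul_mem ha hb
  neg_mem' := by
    intro a ha
    simpa [inv_def] using Γ.inv_mem ha

variable {Γ} in
theorem height_mem_centralLattice {γ : HeisenbergGroup n} (h : γ ∈ Γ) (h0 : proj γ = 0) :
    height γ ∈ centralLattice Γ := by
  have hx : γ.x = 0 := congrArg Prod.fst h0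
  have hy : γ.y = 0 := congrArg Prod.snd h0
  have : γ = ⟨0, 0, height γ⟩ := by ext <;> simp [hx, hy, height]
  change (⟨0, 0, height γ⟩ : HeisenbergGroup n) ∈ Γ
  rwa [← this]

theorem centralLattice_isolated [DiscreteTopology Γ] :
    ∃ ε > 0, ∀ s ∈ centralLattice Γ, |s| < ε → s = 0 := by
  have h1 : IsOpen ({1} : Set Γ) := isOpen_discrete _
  obtain ⟨U, hU, hU1⟩ := isOpen_induced_iff.1 h1
  have hc : Continuous fun s : ℝ => (coord.symm (0, 0, s) : HeisenbergGroup n) :=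
    continuous_coord_symm.comp (by fun_prop)
  have h0 : (0 : ℝ) ∈ (fun s : ℝ => (coord.symm (0, 0, s) : HeisenbergGroup n)) ⁻¹' U := by
    have : (1 : Γ) ∈ Subtype.val ⁻¹' U := by rw [hU1]; rfl
    exact this
  obtain ⟨ε, hε, hb⟩ := Metric.isOpen_iff.1 (hU.preimage hc) 0 h0
  refine ⟨ε, hε, fun s hs hsε => ?_⟩
  have hsU : s ∈ (fun s : ℝ => (coord.symm (0, 0, s) : HeisenbergGroup n)) ⁻¹' U :=
    hb (by simpa using hsε)
  have : (⟨⟨0, 0, s⟩, hs⟩ : Γ) ∈ ({1} : Set Γ) := by rw [← hU1]; exact hsU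
  have h2 := congrArg Subtype.val (Set.mem_singleton_iff.1 this)
  exact congrArg HeisenbergGroup.z h2

/-- The commutator of γ and δ is central, and its height is this value. -/
theorem symplecticForm_mem_centralLattice {γ δ : HeisenbergGroup n} (hγ : γ ∈ Γ) (hδ : δ ∈ Γ) :
    symplecticForm (proj γ) (proj δ) ∈ centralLattice Γ := by
  have h1 : γ * δ * (δ * γ)⁻¹ ∈ Γ := Γ.mul_mem (Γ.mul_mem hγ hδ) (Γ.inv_mem (Γ.mul_mem hδ hγ))
  have h2 := height_mem_centralLattice h1 (by simp; abel)
  convert h2 using 1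
  simp only [height_mul, height_inv, proj_mul, proj_inv, map_add, map_neg, LinearMap.add_apply,
    symplecticForm_self]
  rw [symplecticForm_swap (proj γ) (proj δ)]
  ring

/-- A discrete subgroup of ℝ is cyclic. Were it trivial, the symplectic form would vanish on Λ,
hence on its span, contradicting nondegeneracy. -/
theorem exists_centralLattice_eq (hn : 1 ≤ n) (hΓ : IsLattice Γ) :
    ∃ c : ℝ, c ≠ 0 ∧ centralLattice Γ = AddSubgroup.zmultiples c := by
  have := hΓ.1
  obtain ⟨ε, hε, h⟩ := centralLattice_isolated Γ
  obtain ⟨c, hc⟩ := AddSubgroup.cyclic_of_isolated_zero (H := centralLattice Γ) hε (by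
    rw [Set.disjoint_left]
    intro s hs hs'
    exact hs'.1.ne' (h s hs (by rw [abs_of_pos hs'.1]; exact hs'.2)))
  rw [← AddSubgroup.zmultiples_eq_closure] at hc
  refine ⟨c, ?_, hc⟩
  rintro rfl
  have hσ : ∀ γ ∈ Γ, ∀ δ ∈ Γ, symplecticForm (proj γ) (proj δ) = 0 := fun γ hγ δ hδ => by
    have := symplecticForm_mem_centralLattice Γ hγ hδ
    rw [hc] at this
    simpa using this
  have hspan := span_horizontalLattice Γ hΓ
  have h1 : ∀ γ ∈ Γ, proj γ = 0 := fun γ hγ => symplecticForm_nondegenerate fun w =>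
    LinearMap.congr_fun (eq_zero_of_forall_lattice Γ hspan _ (hσ γ hγ)) w
  have h2 := eq_zero_of_forall_lattice Γ hspan
    (LinearMap.proj (⟨0, hn⟩ : Fin n) ∘ₗ LinearMap.fst ℝ _ _) (fun γ hγ => by simp [h1 γ hγ])
  have h3 := LinearMap.congr_fun h2 (Pi.single ⟨0, hn⟩ 1, 0)
  simp at h3

/-- Projections of discrete groups need not be discrete; here commutators help. A small lattice
vector pairs with a finite spanning set of lattice vectors to small elements of the discrete central
lattice, so all these pairings vanish and the vector is zero. -/
theorem discreteTopology_horizontalLattice (hΓ : IsLattice Γ) :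
    DiscreteTopology (horizontalLattice Γ) := by
  have := hΓ.1
  obtain ⟨ε, hε, h⟩ := centralLattice_isolated Γ
  have hspan := span_horizontalLattice Γ hΓ
  obtain ⟨t, ht, htspan, htli⟩ := exists_linearIndependent ℝ
    (horizontalLattice Γ : Set (Horizontal n))
  have hfin : t.Finite := htli.setFinite
  rw [hspan] at htspan
  have hopen : IsOpen {v : Horizontal n | ∀ w ∈ t, |symplecticForm v w| < ε} := by
    have : {v : Horizontal n | ∀ w ∈ t, |symplecticForm v w| < ε} =
        ⋂ w ∈ t, {v : Horizontal n | |symplecticForm v w| < ε} := by ext; simp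
    rw [this]
    refine hfin.isOpen_biInter fun w _ => isOpen_lt ?_ continuous_const
    exact ((symplecticForm.flip w).continuous_of_finiteDimensional).abs
  rw [discreteTopology_iff_isOpen_singleton_zero, isOpen_induced_iff]
  refine ⟨_, hopen, ?_⟩
  ext ⟨v, hv⟩
  simp only [Set.mem_preimage, Set.mem_ofPred_eq, Set.mem_singleton_iff]
  constructor
  · intro hvt
    obtain ⟨γ, hγ, rfl⟩ := hv
    have h0 : symplecticForm (proj γ) = 0 := LinearMap.ext_on htspan fun w hw => by
      obtain ⟨δ, hδ, rfl⟩ := ht hw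
      exact h _ (symplecticForm_mem_centralLattice Γ hγ hδ) (hvt _ hw)
    exact Subtype.ext (symplecticForm_nondegenerate fun w => by rw [h0]; rfl)
  · intro h0 w _
    have : v = 0 := congrArg Subtype.val h0
    simpa [this] using hε

/-- Coordinates on `H_n` in which `Γ` is rational. -/
structure RationalCoordinates where
  /-- The normalized symplectic form. -/
  σ : Horizontal n →ₗ[ℝ] Horizontal n →ₗ[ℝ] ℝ
  /-- The normalized central coordinate. -/
  ψ : HeisenbergGroup n → ℝ
  σ_self : ∀ v, σ v v = 0
  σ_nondegenerate : ∀ v, (∀ w, σ v w = 0) → v = 0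
  ψ_mul : ∀ g h, ψ (g * h) = ψ g + ψ h + σ (proj g) (proj h) / 2
  ψ_rpow : ∀ g t, ψ (rpow g t) = t * ψ g
  ext_ψ : ∀ {g h}, proj g = proj h → ψ g = ψ h → g = h
  σ_int : ∀ {v w}, v ∈ horizontalLattice Γ → w ∈ horizontalLattice Γ → ∃ k : ℤ, σ v w = k
  ψ_half_int : ∀ {γ}, γ ∈ Γ → ∃ k : ℤ, ψ γ = k / 2
  central : ∃ ζ ∈ Γ, proj ζ = 0 ∧ ψ ζ = 1

/-- Dividing by the central generator makes σ integral. Subtracting a linear function makes the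
central coordinate vanish on lifts of a basis of Λ, and the cocycle σ/2 then keeps it half-integral
on all of Γ. -/
theorem nonempty_rationalCoordinates (hn : 1 ≤ n) (hΓ : IsLattice Γ) :
    Nonempty (RationalCoordinates Γ) := by
  obtain ⟨c, hc0, hc⟩ := exists_centralLattice_eq Γ hn hΓ
  have := discreteTopology_horizontalLattice Γ hΓ
  let L := AddSubgroup.toIntSubmodule (horizontalLattice Γ)
  have hdisc : DiscreteTopology L := this
  have hL : IsZLattice ℝ L := ⟨span_horizontalLattice Γ hΓ⟩
  let b := Module.Free.chooseBasis ℤ L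
  have hlift : ∀ i, ∃ γ ∈ Γ, proj γ = (b i : Horizontal n) := fun i => (b i).2
  choose γ hγ hγb using hlift
  let l : Horizontal n →ₗ[ℝ] ℝ := (b.ofZLatticeBasis ℝ L).constr ℝ fun i => height (γ i)
  have hl : ∀ i, l (proj (γ i)) = height (γ i) := fun i => by
    rw [hγb, ← b.ofZLatticeBasis_apply ℝ L i]
    exact Module.Basis.constr_basis _ _ _ _
  let ψ : HeisenbergGroup n → ℝ := fun g => c⁻¹ * (height g - l (proj g))
  let σ := c⁻¹ • symplecticForm (n := n)
  have hψ_mul : ∀ g h, ψ (g * h) = ψ g + ψ h + σ (proj g) (proj h) / 2 := fun g h => by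
    simp only [ψ, σ, height_mul, proj_mul, map_add, LinearMap.smul_apply, smul_eq_mul]
    ring
  have hψ_inv : ∀ g, ψ g⁻¹ = -ψ g := fun g => by simp [ψ]; ring
  have hcentral : ∀ s ∈ centralLattice Γ, ∃ k : ℤ, c⁻¹ * s = k := fun s hs => by
    rw [hc] at hs
    obtain ⟨k, rfl⟩ := hs
    exact ⟨k, by simp; field_simp⟩
  have hσ_int : ∀ {v w}, v ∈ horizontalLattice Γ → w ∈ horizontalLattice Γ →
      ∃ k : ℤ, σ v w = k := by
    rintro _ _ ⟨g, hg, rfl⟩ ⟨h, hh, rfl⟩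
    exact hcentral _ (symplecticForm_mem_centralLattice Γ hg hh)
  -- This subgroup contains the chosen lifts of a basis, so it projects onto Λ; any element of Γ
  -- differs from one of its elements by a central one, where ψ is an integer.
  let P : Subgroup (HeisenbergGroup n) :=
    { carrier := {g | g ∈ Γ ∧ ∃ k : ℤ, ψ g = k / 2}
      one_mem' := ⟨Γ.one_mem, 0, by simp [ψ, show height (1 : HeisenbergGroup n) = 0 by simp [height, one_def]]⟩
      mul_mem' := by
        rintro g h ⟨hg, k, hk⟩ ⟨hh, m, hm⟩
        obtain ⟨j, hj⟩ := hσ_int (proj_mem_horizontalLattice hg) (proj_mem_horizontalLattice hh)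
        exact ⟨Γ.mul_mem hg hh, k + m + j, by rw [hψ_mul, hk, hm, hj]; push_cast; ring⟩
      inv_mem' := by
        rintro g ⟨hg, k, hk⟩
        exact ⟨Γ.inv_mem hg, -k, by rw [hψ_inv, hk]; push_cast; ring⟩ }
  have hP : L ≤ AddSubgroup.toIntSubmodule (horizontalLattice P) := by
    rw [← b.ofZLatticeBasis_span ℝ L, Submodule.span_le]
    rintro _ ⟨i, rfl⟩
    rw [b.ofZLatticeBasis_apply ℝ L i, ← hγb]
    exact ⟨γ i, ⟨hγ i, 0, by simp [ψ, hl]⟩, rfl⟩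
  refine ⟨⟨σ, ψ, fun v => by simp [σ, symplecticForm_self], fun v hv => ?_, hψ_mul, fun g t => ?_,
    fun {g h} h1 h2 => ?_, hσ_int, fun {g} hg => ?_, ?_⟩⟩
  · refine symplecticForm_nondegenerate fun w => ?_
    simpa [σ, hc0] using hv w
  · simp [ψ]; ring
  · refine ext_proj_height h1 ?_
    simpa [ψ, h1, hc0] using h2
  · obtain ⟨p, ⟨hp, k, hk⟩, hpg⟩ := hP (proj_mem_horizontalLattice hg)
    have h0 : proj (p⁻¹ * g) = 0 := by simp [hpg]
    obtain ⟨m, hm⟩ := hcentral _ (height_mem_centralLattice (Γ.mul_mem (Γ.inv_mem hp) hg) h0)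
    have h1 : ψ (p⁻¹ * g) = m := by simpa [ψ, h0] using hm
    have h2 : g = p * (p⁻¹ * g) := by group
    refine ⟨k + 2 * m, ?_⟩
    rw [h2, hψ_mul, h0, h1, hk]
    simp; ring
  · refine ⟨⟨0, 0, c⟩, ?_, rfl, ?_⟩
    · change c ∈ centralLattice Γ
      rw [hc]; exact AddSubgroup.mem_zmultiples c
    · have : proj (⟨0, 0, c⟩ : HeisenbergGroup n) = 0 := rfl
      simp [ψ, this, height, hc0]

end Torus

/-- The field of rational numbers inside the reals. -/
noncomputable def rationals : Subfield ℝ := (Rat.castHom ℝ).fieldRange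

theorem ratCast_mem_rationals (q : ℚ) : (q : ℝ) ∈ rationals := ⟨q, rfl⟩

theorem countable_rationals : (rationals : Set ℝ).Countable := by
  rw [show (rationals : Set ℝ) = Set.range ((↑) : ℚ → ℝ) from RingHom.coe_fieldRange _]
  exact Set.countable_range _

theorem eq_zero_of_forall_div_two_pow_int {r : ℝ} (h : ∀ k : ℕ, ∃ m : ℤ, r / 2 ^ k = m) :
    r = 0 := by
  obtain ⟨k, hk⟩ := pow_unbounded_of_one_lt |r| (one_lt_two (α := ℝ))
  obtain ⟨m, hm⟩ := h k
  have h1 : |(m : ℝ)| < 1 := by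
    rw [← hm, abs_div, abs_of_pos (by positivity : (0 : ℝ) < 2 ^ k), div_lt_one (by positivity)]
    exact hk
  have h2 : m = 0 := Int.abs_lt_one_iff.1 (by exact_mod_cast h1)
  rw [h2, Int.cast_zero, div_eq_zero_iff] at hm
  exact hm.resolve_right (by positivity)

/-! ### Rational points and finiteness of midpoints -/

namespace RationalCoordinates

variable {n : ℕ} {Γ : Subgroup (HeisenbergGroup n)} (R : RationalCoordinates Γ)

theorem σ_mem_rationals {v w : Horizontal n} (hv : v ∈ horizontalLattice Γ)
    (hw : w ∈ horizontalLattice Γ) : R.σ v w ∈ rationals := by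
  obtain ⟨k, hk⟩ := R.σ_int hv hw
  rw [hk]
  exact intCast_mem _ k

theorem ψ_mem_rationals {γ : HeisenbergGroup n} (h : γ ∈ Γ) : R.ψ γ ∈ rationals := by
  obtain ⟨k, hk⟩ := R.ψ_half_int h
  rw [hk]
  exact div_mem (intCast_mem _ k) (ofNat_mem _ 2)

/-- The rational points of the abelianization. -/
def rationalPoints : AddSubgroup (Horizontal n) where
  carrier := {v | ∀ w ∈ horizontalLattice Γ, R.σ v w ∈ rationals}
  zero_mem' := fun w _ => by simp
  add_mem' := fun ha hb w hw => by
    rw [map_add, LinearMap.add_apply]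
    exact add_mem (ha w hw) (hb w hw)
  neg_mem' := fun ha w hw => by
    rw [map_neg, LinearMap.neg_apply]
    exact neg_mem (ha w hw)

theorem horizontalLattice_le_rationalPoints : horizontalLattice Γ ≤ R.rationalPoints :=
  fun _ hv _ hw => R.σ_mem_rationals hv hw

theorem ψ_mul_central_zpow {ζ : HeisenbergGroup n} (h0 : proj ζ = 0) (h1 : R.ψ ζ = 1)
    (g : HeisenbergGroup n) (k : ℤ) : proj (ζ ^ k) = 0 ∧ R.ψ (g * ζ ^ k) = R.ψ g + k := by
  have hζ : ∀ m : ℤ, proj (ζ ^ m) = 0 := fun m => by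
    induction m with
    | zero => simp
    | succ i ih => rw [zpow_add_one, proj_mul, ih, h0, add_zero]
    | pred i ih => rw [zpow_sub_one, proj_mul, proj_inv, ih, h0, neg_zero, add_zero]
  refine ⟨hζ k, ?_⟩
  have hone : R.ψ 1 = 0 := by simpa using R.ψ_rpow 1 0
  have hinv : R.ψ ζ⁻¹ = -1 := by
    have := R.ψ_mul ζ ζ⁻¹
    simp only [mul_inv_cancel, hone, h1, h0, map_zero, LinearMap.zero_apply] at this
    linarith
  induction k with
  | zero => simp
  | succ i ih =>
    rw [zpow_add_one, ← mul_assoc, R.ψ_mul, ih, h0, h1]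
    simp; ring
  | pred i ih =>
    rw [zpow_sub_one, ← mul_assoc, R.ψ_mul, ih, proj_inv, h0, hinv]
    simp; ring

/-- Halving divides the integers σ(proj γ, ·) and 2ψ(γ) by two each time, and only zero survives
this indefinitely. -/
theorem eq_one_of_forall_roots_mem (R : RationalCoordinates Γ) (hspan : Submodule.span ℝ
    (horizontalLattice Γ : Set (Horizontal n)) = ⊤) {γ : HeisenbergGroup n}
    (h : ∀ k : ℕ, rpow γ (1 / 2 ^ k) ∈ Γ) : γ = 1 := by
  have h1 : R.σ (proj γ) = 0 := eq_zero_of_forall_lattice Γ hspan _ fun δ hδ =>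
    eq_zero_of_forall_div_two_pow_int fun k => by
      obtain ⟨m, hm⟩ := R.σ_int (proj_mem_horizontalLattice (h k)) (proj_mem_horizontalLattice hδ)
      refine ⟨m, ?_⟩
      rw [← hm, proj_rpow, map_smul, LinearMap.smul_apply, smul_eq_mul]
      ring
  have h2 : 2 * R.ψ γ = 0 := eq_zero_of_forall_div_two_pow_int fun k => by
    obtain ⟨m, hm⟩ := R.ψ_half_int (h k)
    refine ⟨m, ?_⟩
    rw [R.ψ_rpow] at hm
    linear_combination 2 * hm
  have hone : R.ψ 1 = 0 := by simpa using R.ψ_rpow 1 0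
  refine R.ext_ψ ?_ (by rw [hone]; linarith)
  exact R.σ_nondegenerate _ fun w => by rw [h1]; rfl

/-- A pair of distinct points is blocked by its midpoints; closed curves are blocked by the
midpoints of their roots. -/
theorem isBlockable_of_isMidpointBlockable (R : RationalCoordinates Γ) (hspan : Submodule.span ℝ
    (horizontalLattice Γ : Set (Horizontal n)) = ⊤) {m₁ m₂ : HeisenbergGroup n ⧸ Γ}
    (h : IsMidpointBlockable Γ m₁ m₂) : IsBlockable Γ m₁ m₂ := by
  induction m₁ using QuotientGroup.induction_on with | _ g₁
  induction m₂ using QuotientGroup.induction_on with | _ g₂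
  have hhalf : (1 / 2 : ℝ) ∈ Set.Icc (0 : ℝ) 1 := by constructor <;> norm_num
  by_cases hg : (g₁ : HeisenbergGroup n ⧸ Γ) = g₂
  · rw [← hg] at h ⊢
    refine ⟨_, h.subset (Set.sdiff_subset (t := {(g₁ : HeisenbergGroup n ⧸ Γ)})), by simp,
      by simp, fun c hc => ?_⟩
    obtain ⟨γ, hγ, hne, hct⟩ := (mem_connectingCurves_mk Γ).1 hc
    rw [inv_mul_cancel, one_mul] at hne hct
    -- The midpoint of the loop itself may be the base point. Halving until the root first leaves Γ
    -- gives a shorter loop along the same curve whose midpoint is not the base point.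
    have hex : ∃ k : ℕ, rpow γ (1 / 2 ^ k) ∉ Γ := by
      by_contra! hall
      exact hne (R.eq_one_of_forall_roots_mem hspan hall)
    classical
    obtain ⟨k, hk, hmin⟩ : ∃ k : ℕ, rpow γ (1 / 2 ^ (k + 1)) ∉ Γ ∧ rpow γ (1 / 2 ^ k) ∈ Γ := by
      have hpos : Nat.find hex ≠ 0 := fun h0 => by
        have := Nat.find_spec hex
        rw [h0] at this
        simp [hγ] at this
      obtain ⟨k, hk⟩ := Nat.exists_eq_succ_of_ne_zero hpos
      refine ⟨k, ?_, ?_⟩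
      · have := Nat.find_spec hex
        rwa [hk] at this
      · exact not_not.1 (Nat.find_min hex (by omega))
    have hroot : rpow (rpow γ (1 / 2 ^ k)) (1 / 2) = rpow γ (1 / 2 ^ (k + 1)) := by
      rw [rpow_rpow]
      congr 1
      field_simp
      ring
    refine ⟨1 / 2 ^ (k + 1), ⟨by positivity, ?_⟩,
      ⟨fun t => (g₁ * rpow (rpow γ (1 / 2 ^ k)) t : HeisenbergGroup n),
      (mem_connectingCurves_mk Γ).2 ⟨_, hmin, ?_, fun t => ?_⟩, ?_⟩, ?_⟩
    · rw [div_le_one (by positivity)]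
      exact one_le_pow₀ one_le_two
    · intro h1
      rw [inv_mul_cancel, one_mul] at h1
      apply hk
      rw [← hroot, h1]
      have : rpow (1 : HeisenbergGroup n) (1 / 2) = 1 := by
        simp [rpow, log, exp, one_def, height]
      rw [this]
      exact Γ.one_mem
    · simp
    · rw [hct, ← hroot]
    · rw [hct, Set.mem_singleton_iff, eq_comm, QuotientGroup.eq]
      simpa using hk
  · have hg' : g₁⁻¹ * g₂ ∉ Γ := fun h' => hg (QuotientGroup.eq.2 h')
    refine ⟨_, h, ?_, ?_, fun c hc => ⟨1 / 2, hhalf, c, hc, rfl⟩⟩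
    · rintro ⟨c, hc, hp⟩
      obtain ⟨γ, hγ, -, hct⟩ := (mem_connectingCurves_mk Γ).1 hc
      rw [hct, QuotientGroup.eq, inv_mul_cancel_left] at hp
      apply hg'
      have h2 := Γ.mul_mem (Γ.mul_mem hp hp) (Γ.inv_mem hγ)
      rwa [rpow_half_mul_self, mul_inv_cancel_right] at h2
    · rintro ⟨c, hc, hp⟩
      obtain ⟨γ, hγ, -, hct⟩ := (mem_connectingCurves_mk Γ).1 hc
      rw [hct, QuotientGroup.eq] at hp
      apply hg'
      have hsq := rpow_half_mul_self (g₁⁻¹ * g₂ * γ)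
      set k := rpow (g₁⁻¹ * g₂ * γ) (1 / 2)
      -- If the midpoint is `g₂Γ`, then ε = g₂⁻¹g₁k lies in Γ, and k² = g₁⁻¹g₂γ turns into g₁⁻¹g₂ =
      -- ε⁻¹γε⁻¹.
      have h2 : g₁⁻¹ * g₂ = (g₂⁻¹ * (g₁ * k))⁻¹ * γ * (g₂⁻¹ * (g₁ * k))⁻¹ := by
        have h3 : γ = g₂⁻¹ * g₁ * (k * k) := by rw [hsq]; group
        rw [h3]; group
      rw [h2]
      exact Γ.mul_mem (Γ.mul_mem (Γ.inv_mem hp) hγ) (Γ.inv_mem hp)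

/-- Λ is finitely generated, so clearing denominators on generators suffices. -/
theorem exists_common_denominator [DiscreteTopology (horizontalLattice Γ)]
    (hspan : Submodule.span ℝ (horizontalLattice Γ : Set (Horizontal n)) = ⊤)
    {v : Horizontal n} (hv : v ∈ R.rationalPoints) :
    ∃ N : ℤ, N ≠ 0 ∧ ∀ w ∈ horizontalLattice Γ, ∃ k : ℤ, R.σ v w = k / N := by
  let L := AddSubgroup.toIntSubmodule (horizontalLattice Γ)
  have hdisc : DiscreteTopology L := ‹_›
  have hL : IsZLattice ℝ L := ⟨hspan⟩
  obtain ⟨S, hS⟩ := ZLattice.FG ℝ L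
  have hq : ∀ w : Horizontal n, ∃ q : ℚ, w ∈ horizontalLattice Γ → R.σ v w = q := fun w => by
    by_cases hw : w ∈ horizontalLattice Γ
    · obtain ⟨q, hq⟩ := hv w hw
      exact ⟨q, fun _ => hq.symm⟩
    · exact ⟨0, fun h => absurd h hw⟩
  choose q hq using hq
  classical
  obtain ⟨N, hN⟩ := IsLocalization.exist_integer_multiples_of_finset (nonZeroDivisors ℤ)
    (S.image q)
  have hN0 : (N : ℤ) ≠ 0 := nonZeroDivisors.coe_ne_zero N
  have hN0' : ((N : ℤ) : ℝ) ≠ 0 := by exact_mod_cast hN0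
  refine ⟨N, hN0, fun w hw => ?_⟩
  have hw' : w ∈ Submodule.span ℤ (S : Set (Horizontal n)) := by rw [hS]; exact hw
  clear hw
  induction hw' using Submodule.span_induction with
  | mem w hw =>
    obtain ⟨k, hk⟩ := hN (q w) (Finset.mem_image_of_mem q hw)
    have hwL : w ∈ horizontalLattice Γ := by
      have : w ∈ L := hS ▸ Submodule.subset_span hw
      exact this
    refine ⟨k, ?_⟩
    rw [hq w hwL, eq_div_iff hN0']
    have hk' : (k : ℚ) = (N : ℤ) * q w := by simpa using hk
    have : ((k : ℚ) : ℝ) = (N : ℤ) * q w := by rw [hk']; push_cast; ring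
    rw [Rat.cast_intCast] at this
    rw [this]; ring
  | zero => exact ⟨0, by simp⟩
  | add a b _ _ ha hb =>
    obtain ⟨k, hk⟩ := ha
    obtain ⟨m, hm⟩ := hb
    exact ⟨k + m, by rw [map_add, hk, hm]; push_cast; ring⟩
  | smul a b _ hb =>
    obtain ⟨k, hk⟩ := hb
    exact ⟨a * k, by rw [map_zsmul, hk]; simp; ring⟩

theorem exists_norm_add_le [DiscreteTopology (horizontalLattice Γ)]
    (hspan : Submodule.span ℝ (horizontalLattice Γ : Set (Horizontal n)) = ⊤) :
    ∃ r : ℝ, ∀ v : Horizontal n, ∃ γ ∈ Γ, ‖v + proj γ‖ ≤ r := by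
  let L := AddSubgroup.toIntSubmodule (horizontalLattice Γ)
  have hdisc : DiscreteTopology L := ‹_›
  have hL : IsZLattice ℝ L := ⟨hspan⟩
  let b := (Module.Free.chooseBasis ℤ L).ofZLatticeBasis ℝ L
  refine ⟨∑ i, ‖b i‖, fun v => ?_⟩
  have h1 : -(ZSpan.floor b v : Horizontal n) ∈ L := by
    have h2 := (Module.Free.chooseBasis ℤ L).ofZLatticeBasis_span ℝ L
    exact neg_mem (h2.le (ZSpan.floor b v).2)
  obtain ⟨γ, hγ, hp⟩ := h1
  refine ⟨γ, hγ, ?_⟩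
  rw [hp, ← sub_eq_add_neg]
  exact ZSpan.norm_fract_le b v

theorem finite_lattice_inter_closedBall [DiscreteTopology (horizontalLattice Γ)] (r : ℝ) :
    {v : Horizontal n | v ∈ horizontalLattice Γ ∧ ‖v‖ ≤ r}.Finite := by
  refine (Metric.finite_isBounded_inter_isClosed (K := Metric.closedBall 0 r)
    (s := (horizontalLattice Γ : Set (Horizontal n))) ?_ Metric.isBounded_closedBall
    (AddSubgroup.isClosed_of_discrete)).subset ?_
  · exact DiscreteTopology.isDiscrete
  · rintro v ⟨hv, hr⟩
    exact ⟨by simpa using hr, hv⟩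

theorem isMidpointBlockable_of_mem_rationalPoints [DiscreteTopology (horizontalLattice Γ)]
    (hspan : Submodule.span ℝ (horizontalLattice Γ : Set (Horizontal n)) = ⊤)
    {g₁ g₂ : HeisenbergGroup n} (h : proj (g₁⁻¹ * g₂) ∈ R.rationalPoints) :
    IsMidpointBlockable Γ g₁ g₂ := by
  obtain ⟨g, hg⟩ : ∃ g, g = g₁⁻¹ * g₂ := ⟨_, rfl⟩
  rw [← hg] at h
  obtain ⟨N, hN0, hN⟩ := R.exists_common_denominator hspan h
  have hN0' : (N : ℝ) ≠ 0 := by exact_mod_cast hN0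
  obtain ⟨r, hr⟩ := exists_norm_add_le hspan
  obtain ⟨ζ, hζ, hζ0, hζ1⟩ := R.central
  let X : Set (Horizontal n) := (fun w => (1 / 2 : ℝ) • (proj g + w)) ''
    {w | w ∈ horizontalLattice Γ ∧ ‖w‖ ≤ 2 * r + ‖proj g‖}
  have hX : X.Finite := (finite_lattice_inter_closedBall _).image _
  -- Taking the half-power halves ψ(γ) ∈ ½ℤ and the cocycle terms σ/2, whence quarters; pairings
  -- with `proj g` contribute the denominator N.
  let Z : Set ℝ := (fun k : ℤ => R.ψ g / 2 + k / (4 * N)) ''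
    {k : ℤ | |k| ≤ ⌈|4 * (N : ℝ)| * (1 + |R.ψ g / 2|)⌉}
  have hZ : Z.Finite := by
    refine Set.Finite.image _ ((Set.finite_Icc _ _).subset fun k hk => abs_le.1 hk)
  have hY : {x : HeisenbergGroup n | proj x ∈ X ∧ R.ψ x ∈ Z}.Finite := by
    refine Set.Finite.preimage (f := fun x : HeisenbergGroup n => (proj x, R.ψ x)) ?_ (hX.prod hZ)
    intro x _ y _ hxy
    exact R.ext_ψ (congrArg Prod.fst hxy) (congrArg Prod.snd hxy)
  refine (hY.image fun x => ((g₁ * x : HeisenbergGroup n) : HeisenbergGroup n ⧸ Γ)).subset ?_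
  rintro _ ⟨c, hc, rfl⟩
  obtain ⟨γ, hγ, -, hct⟩ := (mem_connectingCurves_mk Γ).1 hc
  rw [← hg] at hct
  obtain ⟨δ, hδ, hδr⟩ := hr (proj (rpow (g * γ) (1 / 2)))
  set y := rpow (g * γ) (1 / 2) with hy
  -- Right multiplication by δ bounds the horizontal part; this power of ζ then moves the central
  -- coordinate into [0, 1).
  let m : ℤ := -⌊R.ψ (y * δ)⌋
  obtain ⟨hm0, hm1⟩ := R.ψ_mul_central_zpow hζ0 hζ1 (y * δ) m
  have hδm : δ * ζ ^ m ∈ Γ := Γ.mul_mem hδ (Γ.zpow_mem hζ m)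
  have hproj : proj (y * δ * ζ ^ m) = (1 / 2 : ℝ) • (proj g + (proj γ + (2 : ℝ) • proj δ)) := by
    rw [proj_mul, hm0, proj_mul, hy, proj_rpow, proj_mul]
    module
  refine ⟨y * δ * ζ ^ m, ⟨?_, ?_⟩, ?_⟩
  · rw [hproj]
    refine ⟨_, ⟨?_, ?_⟩, rfl⟩
    · rw [two_smul]
      exact add_mem (proj_mem_horizontalLattice hγ)
        (add_mem (proj_mem_horizontalLattice hδ) (proj_mem_horizontalLattice hδ))
    · have : proj γ + (2 : ℝ) • proj δ = (2 : ℝ) • (proj y + proj δ) - proj g := by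
        rw [hy, proj_rpow, proj_mul]; module
      rw [this]
      refine (norm_sub_le _ _).trans ?_
      rw [norm_smul]
      norm_num
      exact hδr
  · obtain ⟨k₁, h1⟩ := R.ψ_half_int hγ
    obtain ⟨k₂, h2⟩ := hN _ (proj_mem_horizontalLattice hγ)
    obtain ⟨k₃, h3⟩ := R.ψ_half_int hδ
    obtain ⟨k₄, h4⟩ := hN _ (proj_mem_horizontalLattice hδ)
    obtain ⟨k₅, h5⟩ := R.σ_int (proj_mem_horizontalLattice hγ) (proj_mem_horizontalLattice hδ)
    have hval : R.ψ (y * δ * ζ ^ m) = R.ψ g / 2 +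
        ((N * k₁ + k₂ + 2 * N * k₃ + k₄ + N * k₅ + 4 * N * m : ℤ) : ℝ) / (4 * N) := by
      rw [hm1, R.ψ_mul, hy, R.ψ_rpow, R.ψ_mul, proj_rpow, proj_mul, map_smul, map_add,
        LinearMap.smul_apply, LinearMap.add_apply, h1, h2, h3, h4, h5]
      push_cast
      rw [smul_eq_mul]
      field_simp
      ring
    have hfr : R.ψ (y * δ * ζ ^ m) = Int.fract (R.ψ (y * δ)) := by
      rw [hm1, Int.fract]; simp only [m, Int.cast_neg]; ring
    rw [hval]
    refine ⟨_, ?_, rfl⟩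
    set K : ℤ := N * k₁ + k₂ + 2 * N * k₃ + k₄ + N * k₅ + 4 * N * m
    have hK : (K : ℝ) = (4 * N) * (Int.fract (R.ψ (y * δ)) - R.ψ g / 2) := by
      rw [← hfr, hval]; field_simp; ring
    have hle : |(K : ℝ)| ≤ |4 * (N : ℝ)| * (1 + |R.ψ g / 2|) := by
      rw [hK, abs_mul]
      refine mul_le_mul_of_nonneg_left ?_ (abs_nonneg _)
      refine (abs_sub _ _).trans ?_
      rw [abs_of_nonneg (Int.fract_nonneg _)]
      linarith [Int.fract_lt_one (R.ψ (y * δ))]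
    have := hle.trans (Int.le_ceil _)
    exact_mod_cast this
  · rw [hct, eq_comm, QuotientGroup.eq]
    have : (g₁ * y)⁻¹ * (g₁ * (y * δ * ζ ^ m)) = δ * ζ ^ m := by group
    rw [this]
    exact hδm

end RationalCoordinates

/-! ### Blocking forces rationality -/

namespace RationalCoordinates

variable {n : ℕ} {Γ : Subgroup (HeisenbergGroup n)} (R : RationalCoordinates Γ)

/-- The elements γζᵏ share one horizontal path, and the horizontal parts of the returning δ stay
bounded. Hence two exponents k ≠ l share b and `proj δ`, so also t; subtracting central coordinates
shows that t(k - l) is rational. -/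
theorem exists_rational_time (R : RationalCoordinates Γ) [DiscreteTopology (horizontalLattice Γ)]
    {g : HeisenbergGroup n} {B : Set (HeisenbergGroup n)} (hfin : B.Finite)
    (hB : ∀ γ ∈ Γ, ∃ b ∈ B, ∃ δ ∈ Γ, ∃ t : ℝ, 0 < t ∧ t < 1 ∧ rpow (g * γ) t * δ = b)
    (hg : proj g ∉ horizontalLattice Γ) {γ : HeisenbergGroup n} (hγ : γ ∈ Γ) :
    ∃ b ∈ B, ∃ γ' ∈ Γ, ∃ δ ∈ Γ, proj γ' = proj γ ∧
      ∃ t ∈ rationals, 0 < t ∧ t < 1 ∧ rpow (g * γ') t * δ = b := by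
  obtain ⟨ζ, hζ, hζ0, hζ1⟩ := R.central
  have hγζ : ∀ k : ℕ, γ * ζ ^ (k : ℤ) ∈ Γ := fun k => Γ.mul_mem hγ (Γ.zpow_mem hζ k)
  have hpζ : ∀ k : ℕ, proj (ζ ^ (k : ℤ)) = 0 := fun k => (R.ψ_mul_central_zpow hζ0 hζ1 1 k).1
  have hψζ : ∀ k : ℕ, R.ψ (g * (γ * ζ ^ (k : ℤ))) = R.ψ (g * γ) + k := fun k => by
    rw [← mul_assoc, (R.ψ_mul_central_zpow hζ0 hζ1 _ k).2, Int.cast_natCast]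
  have hpγ : ∀ k : ℕ, proj (γ * ζ ^ (k : ℤ)) = proj γ := fun k => by
    rw [proj_mul, hpζ, add_zero]
  have hpg : ∀ k : ℕ, proj (g * (γ * ζ ^ (k : ℤ))) = proj (g * γ) := fun k => by
    rw [proj_mul g, hpγ, proj_mul g]
  choose b hb δ hδ t ht0 ht1 heq using fun k : ℕ => hB _ (hγζ k)
  have hpeq : ∀ k, t k • proj (g * γ) + proj (δ k) = proj (b k) := fun k => by
    rw [← heq k, proj_mul (rpow _ _), proj_rpow, hpg]
  obtain ⟨r, hr⟩ : ∃ r, ∀ b ∈ B, ‖proj b‖ ≤ r := by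
    obtain ⟨r, hr⟩ := (hfin.image fun b => ‖proj b‖).bddAbove
    exact ⟨r, fun b hb => hr ⟨b, hb, rfl⟩⟩
  have hmaps : ∀ k, (b k, proj (δ k)) ∈
      B ×ˢ {v : Horizontal n | v ∈ horizontalLattice Γ ∧ ‖v‖ ≤ r + ‖proj (g * γ)‖} := fun k => by
    refine ⟨hb k, proj_mem_horizontalLattice (hδ k), ?_⟩
    change ‖proj (δ k)‖ ≤ _
    rw [eq_sub_of_add_eq' (hpeq k)]
    refine (norm_sub_le _ _).trans (add_le_add (hr _ (hb k)) ?_)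
    rw [norm_smul, Real.norm_of_nonneg (ht0 k).le]
    exact mul_le_of_le_one_left (norm_nonneg _) (ht1 k).le
  obtain ⟨k, -, l, -, hkl, hpair⟩ := Set.infinite_univ.exists_ne_map_eq_of_mapsTo
    (fun k _ => hmaps k) (hfin.prod (finite_lattice_inter_closedBall _))
  have hbkl : b k = b l := congrArg Prod.fst hpair
  have hδkl : proj (δ k) = proj (δ l) := congrArg Prod.snd hpair
  have hne : proj (g * γ) ≠ 0 := fun h0 => hg (by
    rw [proj_mul] at h0
    rw [eq_neg_of_add_eq_zero_left h0]
    exact neg_mem (proj_mem_horizontalLattice hγ))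
  have htkl : t k = t l := by
    have h1 := hpeq k
    rw [hbkl, ← hpeq l, hδkl] at h1
    exact smul_left_injective ℝ hne (add_right_cancel h1)
  have hψeq : ∀ k, t k * (R.ψ (g * γ) + k) + R.ψ (δ k) +
      t k * R.σ (proj (g * γ)) (proj (δ k)) / 2 = R.ψ (b k) := fun k => by
    rw [← heq k, R.ψ_mul (rpow _ _), R.ψ_rpow, hψζ, proj_rpow, hpg, map_smul,
      LinearMap.smul_apply, smul_eq_mul]
  have h1 := hψeq k
  have h2 := hψeq l
  rw [hbkl, htkl, hδkl] at h1
  have hkl' : (k : ℝ) - l ≠ 0 := sub_ne_zero.2 (by exact_mod_cast hkl)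
  refine ⟨b l, hb l, _, hγζ l, δ l, hδ l, hpγ l, t l, ?_, ht0 l, ht1 l, heq l⟩
  have h3 : t l = (R.ψ (δ l) - R.ψ (δ k)) / (k - l) := by
    rw [eq_div_iff hkl']; linarith
  rw [h3]
  exact div_mem (sub_mem (R.ψ_mem_rationals (hδ l)) (R.ψ_mem_rationals (hδ k)))
    (sub_mem (natCast_mem _ k) (natCast_mem _ l))

/-- Two curves with horizontal parts shifted by kη and lη meet the same b at rational times. Equal
times are compared in the central coordinate, different times through the horizontal pairing with η;
each gives an equation for s = σ(g, η). -/
theorem mem_rationalPoints_of_blocking [DiscreteTopology (horizontalLattice Γ)]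
    {g : HeisenbergGroup n} {B : Set (HeisenbergGroup n)} (hfin : B.Finite)
    (hB : ∀ γ ∈ Γ, ∃ b ∈ B, ∃ δ ∈ Γ, ∃ t : ℝ, 0 < t ∧ t < 1 ∧ rpow (g * γ) t * δ = b)
    (hg : proj g ∉ horizontalLattice Γ) : proj g ∈ R.rationalPoints := by
  rintro _ ⟨η, hη, rfl⟩
  choose b hb γ hγ δ hδ hp t htQ ht0 ht1 heq using
    fun k : ℕ => R.exists_rational_time hfin hB hg (Γ.pow_mem hη k)
  have hp' : ∀ k : ℕ, proj (γ k) = (k : ℝ) • proj η := fun k => by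
    rw [hp]
    induction k with
    | zero => simp
    | succ i ih => rw [pow_succ, proj_mul, ih]; push_cast; module
  obtain ⟨k, -, l, -, hkl, hbkl⟩ := Set.infinite_univ.exists_ne_map_eq_of_mapsTo
    (fun k _ => hb k) hfin
  have hpeq : ∀ k, proj (δ k) = proj (b k) - (t k • proj g + (t k * k) • proj η) := fun k => by
    rw [← heq k, proj_mul, proj_rpow, proj_mul g, hp']; module
  set s := R.σ (proj g) (proj η) with hs
  by_cases htkl : t k = t l
  · have hψeq : ∀ k, t k * (R.ψ g + R.ψ (γ k) + k * s / 2) + R.ψ (δ k) +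
        t k * (R.σ (proj g) (proj (b k)) - t k * k * s + R.σ (proj (γ k)) (proj (δ k))) / 2
          = R.ψ (b k) := fun k => by
      have h1 : R.σ (proj g) (proj (δ k)) = R.σ (proj g) (proj (b k)) - t k * k * s := by
        rw [hpeq, map_sub, map_add, map_smul, map_smul, R.σ_self]; simp [hs]
      rw [← h1]
      conv_rhs => rw [← heq k]
      rw [R.ψ_mul, R.ψ_rpow, R.ψ_mul, proj_rpow, proj_mul g, map_smul, map_add,
        LinearMap.smul_apply, LinearMap.add_apply, smul_eq_mul]
      have h4 : R.σ (proj g) (proj (γ k)) = k * s := by rw [hp', map_smul, smul_eq_mul]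
      rw [h4]
    have h1 := hψeq k
    have h2 := hψeq l
    rw [hbkl, htkl] at h1
    -- This is the coefficient of s in the difference of the two central equations; it is nonzero
    -- because blocking points are not endpoints.
    have hne : t l * (1 - t l) * (k - l) / 2 ≠ 0 := by
      have h3 : (k : ℝ) - l ≠ 0 := sub_ne_zero.2 (by exact_mod_cast hkl)
      have h4 : 1 - t l ≠ 0 := by linarith [ht1 l]
      have h5 := (ht0 l).ne'
      positivity
    have h3 : s = (t l * (R.ψ (γ l) - R.ψ (γ k)) + (R.ψ (δ l) - R.ψ (δ k)) +
        t l * (R.σ (proj (γ l)) (proj (δ l)) - R.σ (proj (γ k)) (proj (δ k))) / 2) /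
        (t l * (1 - t l) * (k - l) / 2) := by
      rw [eq_div_iff hne]
      linear_combination h1 - h2
    rw [h3]
    have hψγ := fun i => R.ψ_mem_rationals (hγ i)
    have hψδ := fun i => R.ψ_mem_rationals (hδ i)
    have hσ := fun i => R.σ_mem_rationals (proj_mem_horizontalLattice (hγ i))
      (proj_mem_horizontalLattice (hδ i))
    have h2 : (2 : ℝ) ∈ rationals := ofNat_mem _ 2
    exact div_mem (add_mem (add_mem (mul_mem (htQ l) (sub_mem (hψγ l) (hψγ k)))
      (sub_mem (hψδ l) (hψδ k))) (div_mem (mul_mem (htQ l) (sub_mem (hσ l) (hσ k))) h2))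
      (div_mem (mul_mem (mul_mem (htQ l) (sub_mem (one_mem _) (htQ l)))
        (sub_mem (natCast_mem _ k) (natCast_mem _ l))) h2)
  · have hσ : ∀ k, R.σ (proj (δ k)) (proj η) = R.σ (proj (b k)) (proj η) - t k * s := fun k => by
      rw [hpeq]; simp [R.σ_self, hs]
    have h1 := hσ k
    have h2 := hσ l
    rw [hbkl] at h1
    have hηΛ := proj_mem_horizontalLattice hη
    have h3 : s = (R.σ (proj (δ l)) (proj η) - R.σ (proj (δ k)) (proj η)) / (t k - t l) := by
      rw [eq_div_iff (sub_ne_zero.2 htkl)]; linarith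
    rw [h3]
    exact div_mem (sub_mem (R.σ_mem_rationals (proj_mem_horizontalLattice (hδ l)) hηΛ)
      (R.σ_mem_rationals (proj_mem_horizontalLattice (hδ k)) hηΛ)) (sub_mem (htQ k) (htQ l))

theorem mem_rationalPoints_of_isBlockable [DiscreteTopology (horizontalLattice Γ)]
    {g₁ g₂ : HeisenbergGroup n} (h : IsBlockable Γ g₁ g₂) :
    proj (g₁⁻¹ * g₂) ∈ R.rationalPoints := by
  by_contra hnot
  have hg : proj (g₁⁻¹ * g₂) ∉ horizontalLattice Γ :=
    fun h' => hnot (R.horizontalLattice_le_rationalPoints h')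
  obtain ⟨B, hfin, h1, h2, hB⟩ := h
  refine hnot (R.mem_rationalPoints_of_blocking (hfin.image fun m => g₁⁻¹ * Quotient.out m)
    (fun γ hγ => ?_) hg)
  have hne : g₁⁻¹ * g₂ * γ ≠ 1 := fun h' => hg (by
    rw [eq_inv_of_mul_eq_one_left h']
    exact proj_mem_horizontalLattice (Γ.inv_mem hγ))
  obtain ⟨t, ⟨ht0, ht1⟩, ht⟩ := hB _ ((mem_connectingCurves_mk Γ).2 ⟨γ, hγ, hne, fun _ => rfl⟩)
  refine ⟨_, ⟨_, ht, rfl⟩, (g₁ * rpow (g₁⁻¹ * g₂ * γ) t)⁻¹ *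
    Quotient.out ((g₁ * rpow (g₁⁻¹ * g₂ * γ) t : HeisenbergGroup n) : HeisenbergGroup n ⧸ Γ),
    ?_, t, ?_, ?_, by group⟩
  · rw [← QuotientGroup.eq]
    exact (Quotient.out_eq _).symm
  · refine ht0.lt_of_ne ?_
    rintro rfl
    simp [h1] at ht
  · refine ht1.lt_of_ne ?_
    rintro rfl
    rw [rpow_one, mul_assoc, mul_inv_cancel_left, QuotientGroup.mk_mul_of_mem _ hγ] at ht
    exact h2 ht

theorem isBlockable_mk_iff (R : RationalCoordinates Γ) [DiscreteTopology (horizontalLattice Γ)]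
    (hspan : Submodule.span ℝ (horizontalLattice Γ : Set (Horizontal n)) = ⊤)
    {g₁ g₂ : HeisenbergGroup n} :
    IsBlockable Γ g₁ g₂ ↔ proj g₂ - proj g₁ ∈ R.rationalPoints := by
  rw [show proj g₂ - proj g₁ = proj (g₁⁻¹ * g₂) by simp; abel]
  exact ⟨R.mem_rationalPoints_of_isBlockable, fun h =>
    R.isBlockable_of_isMidpointBlockable hspan (R.isMidpointBlockable_of_mem_rationalPoints hspan h)⟩

theorem isBlockable_iff_isMidpointBlockable (R : RationalCoordinates Γ) [DiscreteTopology (horizontalLattice Γ)]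
    (hspan : Submodule.span ℝ (horizontalLattice Γ : Set (Horizontal n)) = ⊤)
    (m₁ m₂ : HeisenbergGroup n ⧸ Γ) : IsBlockable Γ m₁ m₂ ↔ IsMidpointBlockable Γ m₁ m₂ := by
  refine ⟨fun h => ?_, R.isBlockable_of_isMidpointBlockable hspan⟩
  induction m₁ using QuotientGroup.induction_on with | _ g₁
  induction m₂ using QuotientGroup.induction_on with | _ g₂
  exact R.isMidpointBlockable_of_mem_rationalPoints hspan (R.mem_rationalPoints_of_isBlockable h)

/-- The torus points which are images of rational points. -/
def rationalTorusPoints : Set (Horizontal n ⧸ horizontalLattice Γ) :=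
  QuotientAddGroup.mk '' (R.rationalPoints : Set (Horizontal n))

theorem isBlockable_iff_torusProj [DiscreteTopology (horizontalLattice Γ)]
    (hspan : Submodule.span ℝ (horizontalLattice Γ : Set (Horizontal n)) = ⊤)
    (m₁ m₂ : HeisenbergGroup n ⧸ Γ) :
    IsBlockable Γ m₁ m₂ ↔ torusProj Γ m₂ - torusProj Γ m₁ ∈ R.rationalTorusPoints := by
  induction m₁ using QuotientGroup.induction_on with | _ g₁
  induction m₂ using QuotientGroup.induction_on with | _ g₂
  rw [R.isBlockable_mk_iff hspan]
  refine ⟨fun h => ⟨_, h, rfl⟩, ?_⟩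
  rintro ⟨v, hv, hvg⟩
  have h1 : -v + (proj g₂ - proj g₁) ∈ horizontalLattice Γ := QuotientAddGroup.eq.1 hvg
  have h2 := add_mem hv (R.horizontalLattice_le_rationalPoints h1)
  rwa [add_neg_cancel_left] at h2

/-- A vector is determined by its pairings with a finite spanning set in Λ, and these are rational.
-/
theorem countable_rationalPoints (hspan : Submodule.span ℝ
    (horizontalLattice Γ : Set (Horizontal n)) = ⊤) :
    (R.rationalPoints : Set (Horizontal n)).Countable := by
  obtain ⟨t, ht, htspan, htli⟩ := exists_linearIndependent ℝ
    (horizontalLattice Γ : Set (Horizontal n))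
  have : Finite t := htli.setFinite
  rw [hspan] at htspan
  have hc : (Set.univ.pi fun _ : t => (rationals : Set ℝ)).Countable :=
    Set.countable_univ_pi fun _ => countable_rationals
  have hmaps : Set.MapsTo (fun v (w : t) => R.σ v w) (R.rationalPoints : Set (Horizontal n))
      (Set.univ.pi fun _ : t => (rationals : Set ℝ)) := fun v hv w _ => hv _ (ht w.2)
  refine hmaps.countable_of_injOn (fun v _ w _ hvw => ?_) hc
  have h0 : R.σ (v - w) = 0 := LinearMap.ext_on htspan fun u hu => by
    have := congrFun hvw ⟨u, hu⟩
    simpa [sub_eq_zero] using this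
  exact sub_eq_zero.1 (R.σ_nondegenerate _ fun u => by rw [h0]; rfl)

/-- Rational multiples of lattice vectors are rational points, so the closure, a subgroup, contains
every real line through a lattice vector. -/
theorem dense_rationalPoints (hspan : Submodule.span ℝ
    (horizontalLattice Γ : Set (Horizontal n)) = ⊤) :
    Dense (R.rationalPoints : Set (Horizontal n)) := by
  have hsmul : ∀ v ∈ horizontalLattice Γ, ∀ r : ℝ,
      r • v ∈ R.rationalPoints.topologicalClosure := fun v hv r => by
    have hcont : Continuous fun r : ℝ => r • v := by fun_prop
    have hmaps : Set.MapsTo (fun r : ℝ => r • v) (Set.range ((↑) : ℚ → ℝ))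
        (R.rationalPoints : Set (Horizontal n)) := by
      rintro _ ⟨q, rfl⟩ w hw
      rw [map_smul, LinearMap.smul_apply, smul_eq_mul]
      exact mul_mem (ratCast_mem_rationals q) (R.σ_mem_rationals hv hw)
    have := map_mem_closure hcont (Rat.denseRange_cast r) hmaps
    exact this
  intro v
  have hv : v ∈ Submodule.span ℝ (horizontalLattice Γ : Set (Horizontal n)) := by
    rw [hspan]; trivial
  change v ∈ R.rationalPoints.topologicalClosure
  induction hv using Submodule.closure_induction with
  | zero => exact zero_mem _
  | add a b _ _ ha hb => exact add_mem ha hb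
  | smul_mem r v hv => exact hsmul v hv r

end RationalCoordinates

/-! ### Fibres of the difference map as submanifolds -/

section Submanifolds

open Topology

variable {n : ℕ} (Γ : Subgroup (HeisenbergGroup n))

theorem exists_local_section [DiscreteTopology (horizontalLattice Γ)] :
    ∃ r > 0, ∃ s : Horizontal n ⧸ horizontalLattice Γ → Horizontal n,
      ∀ v : Horizontal n, ‖v‖ < r → s v = v := by
  obtain ⟨U, hU, hU0⟩ := isOpen_induced_iff.1 (isOpen_discrete ({0} : Set (horizontalLattice Γ)))
  have h0 : (0 : Horizontal n) ∈ U := by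
    have : (0 : horizontalLattice Γ) ∈ Subtype.val ⁻¹' U := by rw [hU0]; rfl
    exact this
  obtain ⟨ε, hε, hb⟩ := Metric.isOpen_iff.1 hU 0 h0
  have hsmall : ∀ v ∈ horizontalLattice Γ, ‖v‖ < ε → v = 0 := fun v hv hvε => by
    have h1 : (⟨v, hv⟩ : horizontalLattice Γ) ∈ Subtype.val ⁻¹' U := hb (by simpa using hvε)
    rw [hU0] at h1
    exact congrArg Subtype.val (Set.mem_singleton_iff.1 h1)
  classical
  let s : Horizontal n ⧸ horizontalLattice Γ → Horizontal n := fun τ =>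
    if h : ∃ v : Horizontal n, ‖v‖ < ε / 2 ∧ (v : Horizontal n ⧸ horizontalLattice Γ) = τ
      then h.choose else 0
  refine ⟨ε / 2, half_pos hε, s, fun v hv => ?_⟩
  have h : ∃ w : Horizontal n, ‖w‖ < ε / 2 ∧ (w : Horizontal n ⧸ horizontalLattice Γ) = v :=
    ⟨v, hv, rfl⟩
  have hs : s v = h.choose := dif_pos h
  obtain ⟨h1, h2⟩ := h.choose_spec
  rw [hs]
  have h3 := hsmall _ (QuotientAddGroup.eq.1 h2) (by
    refine (norm_add_le _ _).trans_lt ?_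
    rw [norm_neg]
    linarith)
  exact (neg_add_eq_zero.1 h3)

/-- The difference of the projections of two points to the abelianization. -/
noncomputable def projDiff (n : ℕ) :
    HeisenbergAlgebra n × HeisenbergAlgebra n →L[ℝ] Horizontal n :=
  let P : HeisenbergAlgebra n →L[ℝ] Horizontal n :=
    (ContinuousLinearMap.fst ℝ _ _).prod
      ((ContinuousLinearMap.fst ℝ _ _).comp (ContinuousLinearMap.snd ℝ _ _))
  P.comp (ContinuousLinearMap.snd ℝ _ _) - P.comp (ContinuousLinearMap.fst ℝ _ _)

theorem projDiff_apply (w : HeisenbergAlgebra n × HeisenbergAlgebra n) :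
    projDiff n w = proj (coord.symm w.2) - proj (coord.symm w.1) := rfl

theorem projDiff_surjective : Function.Surjective (projDiff n) := fun v =>
  ⟨(0, (v.1, v.2, 0)), by simp [projDiff_apply, proj, coord]⟩

theorem torusProj_pairCover (w : HeisenbergAlgebra n × HeisenbergAlgebra n) :
    torusProj Γ (pairCover Γ w).2 - torusProj Γ (pairCover Γ w).1 =
      (projDiff n w : Horizontal n ⧸ horizontalLattice Γ) := rfl

theorem isClosedSubmanifold_torusProj_fiber [DiscreteTopology (horizontalLattice Γ)]
    (v : Horizontal n) :
    IsClosedSubmanifold Γ {p | torusProj Γ p.2 - torusProj Γ p.1 =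
      (v : Horizontal n ⧸ horizontalLattice Γ)} (n + n) := by
  have hcl : IsClosed (horizontalLattice Γ : Set (Horizontal n)) := AddSubgroup.isClosed_of_discrete
  have hcont : Continuous fun p : (HeisenbergGroup n ⧸ Γ) × (HeisenbergGroup n ⧸ Γ) =>
      torusProj Γ p.2 - torusProj Γ p.1 :=
    ((continuous_torusProj Γ).comp continuous_snd).sub
      ((continuous_torusProj Γ).comp continuous_fst)
  obtain ⟨r, hr, s, hs⟩ := exists_local_section Γ
  let e : Horizontal n ≃L[ℝ] (Fin (n + n) → ℝ) := ContinuousLinearEquiv.ofFinrankEq (by simp)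
  let F : (HeisenbergGroup n ⧸ Γ) × (HeisenbergGroup n ⧸ Γ) → (Fin (n + n) → ℝ) :=
    fun p => e (s (torusProj Γ p.2 - torusProj Γ p.1 - v))
  let U : Set ((HeisenbergGroup n ⧸ Γ) × (HeisenbergGroup n ⧸ Γ)) :=
    {p | torusProj Γ p.2 - torusProj Γ p.1 - v ∈
      (QuotientAddGroup.mk '' Metric.ball (0 : Horizontal n) r :
        Set (Horizontal n ⧸ horizontalLattice Γ))}
  have hU : IsOpen U :=
    (QuotientAddGroup.isOpenMap_coe _ Metric.isOpen_ball).preimage (hcont.sub continuous_const)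
  have hlocal : ∀ w ∈ pairCover Γ ⁻¹' U, ∃ a : Horizontal n,
      F ∘ pairCover Γ =ᶠ[𝓝 w] fun w' => e (projDiff n w' - a) := by
    rintro w ⟨u, hu, huw⟩
    rw [torusProj_pairCover, ← QuotientAddGroup.mk_sub, QuotientAddGroup.eq] at huw
    -- This is the representative of v modulo Λ that lies at displacement u from `projDiff n w`;
    -- near w the section selects the same representative.
    refine ⟨projDiff n w - u, ?_⟩
    have hopen : IsOpen {w' | ‖projDiff n w' - (projDiff n w - u)‖ < r} :=
      isOpen_lt (by fun_prop) continuous_const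
    filter_upwards [hopen.mem_nhds (by simpa using hu)] with w' hw'
    have h1 : ((projDiff n w' - (projDiff n w - u) : Horizontal n) :
        Horizontal n ⧸ horizontalLattice Γ) = (projDiff n w' - v : Horizontal n) := by
      rw [QuotientAddGroup.eq]
      convert huw using 1
      abel
    change e (s (torusProj Γ (pairCover Γ w').2 - torusProj Γ (pairCover Γ w').1 - v)) = _
    rw [torusProj_pairCover, ← QuotientAddGroup.mk_sub, ← h1, hs _ hw']
  refine ⟨isClosed_singleton.preimage hcont, fun p hp => ⟨U, hU, ?_, F, ?_, ?_, ?_⟩⟩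
  · have h0 : torusProj Γ p.2 - torusProj Γ p.1 - v = 0 := sub_eq_zero.2 hp
    exact ⟨0, Metric.mem_ball_self hr, h0.symm⟩
  · intro w hw
    obtain ⟨a, ha⟩ := hlocal w hw
    refine (ContDiffAt.congr_of_eventuallyEq ?_ ha).contDiffWithinAt
    exact (e.contDiff.comp ((projDiff n).contDiff.sub contDiff_const)).contDiffAt
  · intro w hw
    obtain ⟨a, ha⟩ := hlocal w hw
    have hd : HasFDerivAt (fun w' => e (projDiff n w' - a))
        ((e : Horizontal n →L[ℝ] (Fin (n + n) → ℝ)).comp (projDiff n)) w :=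
      e.hasFDerivAt.comp w ((projDiff n).hasFDerivAt.sub_const a)
    rw [ha.fderiv_eq, hd.fderiv]
    exact e.surjective.comp projDiff_surjective
  · ext q
    refine and_comm.trans (and_congr_right ?_)
    rintro ⟨u, hu, huq⟩
    have hu' : ‖u‖ < r := by simpa using hu
    have hF : F q = e u := by
      change e (s _) = _
      rw [← huq, hs u hu']
    have hs0 : s 0 = 0 := hs 0 (by simpa using hr)
    rw [hF, Set.mem_ofPred_eq, ← sub_eq_zero, ← huq, map_eq_zero_iff e e.injective]
    constructor
    · intro h
      rw [← hs u hu', h, hs0]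
    · rintro rfl; rfl

theorem continuous_pairCover : Continuous (pairCover Γ) :=
  (QuotientGroup.continuous_mk.comp (continuous_coord_symm.comp continuous_fst)).prodMk
    (QuotientGroup.continuous_mk.comp (continuous_coord_symm.comp continuous_snd))

theorem pairCover_surjective : Function.Surjective (pairCover Γ) := by
  rintro ⟨m₁, m₂⟩
  induction m₁ using QuotientGroup.induction_on with | _ g₁
  induction m₂ using QuotientGroup.induction_on with | _ g₂
  exact ⟨(coord g₁, coord g₂), by simp [pairCover]⟩

end Submanifolds

/-! ### Density, countable union and measure zero -/

namespace RationalCoordinates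

variable {n : ℕ} {Γ : Subgroup (HeisenbergGroup n)} (R : RationalCoordinates Γ)

theorem dense_isBlockable (R : RationalCoordinates Γ) [DiscreteTopology (horizontalLattice Γ)]
    (hspan : Submodule.span ℝ (horizontalLattice Γ : Set (Horizontal n)) = ⊤) :
    Dense {p : (HeisenbergGroup n ⧸ Γ) × (HeisenbergGroup n ⧸ Γ) | IsBlockable Γ p.1 p.2} := by
  have hopen : IsOpenMap (projDiff n) :=
    ContinuousLinearMap.isOpenMap _ projDiff_surjective
  have h1 := (R.dense_rationalPoints hspan).preimage hopen
  have h2 := (pairCover_surjective Γ).denseRange.dense_image (continuous_pairCover Γ) h1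
  refine h2.mono ?_
  rintro _ ⟨w, hw, rfl⟩
  refine (R.isBlockable_iff_torusProj hspan _ _).2 ?_
  rw [torusProj_pairCover]
  exact ⟨_, hw, rfl⟩

theorem exists_isBlockable_eq_iUnion (R : RationalCoordinates Γ) (hn : 1 ≤ n)
    [DiscreteTopology (horizontalLattice Γ)]
    (hspan : Submodule.span ℝ (horizontalLattice Γ : Set (Horizontal n)) = ⊤) :
    ∃ (S : ℕ → Set ((HeisenbergGroup n ⧸ Γ) × (HeisenbergGroup n ⧸ Γ))) (k : ℕ → ℕ),
      (∀ i, 0 < k i ∧ IsClosedSubmanifold Γ (S i) (k i)) ∧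
      {p : (HeisenbergGroup n ⧸ Γ) × (HeisenbergGroup n ⧸ Γ) | IsBlockable Γ p.1 p.2} =
        ⋃ i, S i := by
  obtain ⟨f, hf⟩ := (R.countable_rationalPoints hspan).exists_eq_range ⟨0, zero_mem _⟩
  refine ⟨fun i => {p | torusProj Γ p.2 - torusProj Γ p.1 =
      (f i : Horizontal n ⧸ horizontalLattice Γ)}, fun _ => n + n,
    fun i => ⟨Nat.add_pos_left hn n, isClosedSubmanifold_torusProj_fiber Γ (f i)⟩, ?_⟩
  ext p
  rw [Set.mem_ofPred_eq, R.isBlockable_iff_torusProj hspan, rationalTorusPoints, hf,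
    ← Set.range_comp, Set.mem_iUnion]
  exact exists_congr fun i => eq_comm

theorem infinite_torus (R : RationalCoordinates Γ) (hn : 1 ≤ n)
    (hspan : Submodule.span ℝ (horizontalLattice Γ : Set (Horizontal n)) = ⊤) :
    Infinite (Horizontal n ⧸ horizontalLattice Γ) := by
  by_contra hfin
  rw [not_infinite_iff_finite] at hfin
  have hΛ : Countable (horizontalLattice Γ) :=
    ((R.countable_rationalPoints hspan).mono R.horizontalLattice_le_rationalPoints).to_subtype
  have hE : Countable (Horizontal n) :=
    (AddSubgroup.addGroupEquivQuotientProdAddSubgroup (s := horizontalLattice Γ)).countable_iff.2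
      inferInstance
  have hinj : Function.Injective fun r : ℝ => ((fun _ => r, 0) : Horizontal n) :=
    fun a b hab => congrFun (congrArg Prod.fst hab) ⟨0, hn⟩
  exact Cardinal.not_countable_real (Set.countable_univ_iff.2 hinj.countable)

/-- By invariance all fibres have the same measure, and there are infinitely many of them in a space
of finite measure. -/
theorem measure_torusProj_fiber (R : RationalCoordinates Γ) (hn : 1 ≤ n)
    [DiscreteTopology (horizontalLattice Γ)]
    (hspan : Submodule.span ℝ (horizontalLattice Γ : Set (Horizontal n)) = ⊤)
    (μ : Measure (HeisenbergGroup n ⧸ Γ)) [IsFiniteMeasure μ]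
    [SMulInvariantMeasure (HeisenbergGroup n) (HeisenbergGroup n ⧸ Γ) μ]
    (τ : Horizontal n ⧸ horizontalLattice Γ) : μ (torusProj Γ ⁻¹' {τ}) = 0 := by
  have hcl : IsClosed (horizontalLattice Γ : Set (Horizontal n)) := AddSubgroup.isClosed_of_discrete
  have hinf := R.infinite_torus hn hspan
  have hconst : ∀ τ', μ (torusProj Γ ⁻¹' {τ'}) = μ (torusProj Γ ⁻¹' {τ}) := fun τ' => by
    obtain ⟨v, hv⟩ := QuotientAddGroup.mk_surjective (τ - τ')
    rw [← measure_preimage_torusProj_add Γ μ v (measurableSet_singleton τ)]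
    congr 2
    ext x
    simp only [Set.mem_singleton_iff, Set.mem_preimage, hv]
    rw [sub_add_eq_add_sub, sub_eq_iff_eq_add, add_right_inj]
  by_contra hne
  have htop := (Set.infinite_univ (α := Horizontal n ⧸ horizontalLattice Γ)).meas_eq_top
    (μ := μ.map (torusProj Γ)) ⟨_, hne, fun τ' _ => by
      rw [Measure.map_apply (measurable_torusProj Γ) (measurableSet_singleton τ'), hconst τ']⟩
  exact measure_ne_top _ _ htop

theorem ae_not_isBlockable (R : RationalCoordinates Γ) (hn : 1 ≤ n)
    [DiscreteTopology (horizontalLattice Γ)]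
    (hspan : Submodule.span ℝ (horizontalLattice Γ : Set (Horizontal n)) = ⊤)
    (μ : Measure (HeisenbergGroup n ⧸ Γ)) [IsFiniteMeasure μ]
    [SMulInvariantMeasure (HeisenbergGroup n) (HeisenbergGroup n ⧸ Γ) μ] :
    ∀ᵐ p ∂(μ.prod μ), ¬ IsBlockable Γ p.1 p.2 := by
  have hcl : IsClosed (horizontalLattice Γ : Set (Horizontal n)) := AddSubgroup.isClosed_of_discrete
  have hC : R.rationalTorusPoints.Countable := (R.countable_rationalPoints hspan).image _
  have hborel : BorelSpace (Horizontal n ⧸ horizontalLattice Γ) := inferInstance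
  have hmeas : Measurable fun p : (HeisenbergGroup n ⧸ Γ) × (HeisenbergGroup n ⧸ Γ) =>
      torusProj Γ p.2 - torusProj Γ p.1 :=
    ((measurable_torusProj Γ).comp measurable_snd).sub
      ((measurable_torusProj Γ).comp measurable_fst)
  simp only [R.isBlockable_iff_torusProj hspan]
  rw [ae_iff]
  simp only [not_not]
  -- With the first point fixed, the blockable second points lie in countably many null fibres.
  refine (Measure.measure_prod_null (hmeas hC.measurableSet)).2 (Filter.Eventually.of_forall ?_)
  intro m
  have hsub : Prod.mk m ⁻¹' ((fun p : (HeisenbergGroup n ⧸ Γ) × (HeisenbergGroup n ⧸ Γ) =>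
      torusProj Γ p.2 - torusProj Γ p.1) ⁻¹' R.rationalTorusPoints) ⊆
      ⋃ c ∈ R.rationalTorusPoints, torusProj Γ ⁻¹' {c + torusProj Γ m} := by
    intro m' hm'
    simp only [Set.mem_iUnion]
    exact ⟨_, hm', by simp⟩
  exact measure_mono_null hsub ((measure_biUnion_null_iff hC).2 fun c _ =>
    R.measure_torusProj_fiber hn hspan μ _)

end RationalCoordinates

end HeisenbergGroup

theorem mainTheorem7 (n : ℕ) (hn : 1 ≤ n) (Γ : Subgroup (HeisenbergGroup n))
    (hΓ : HeisenbergGroup.IsLattice Γ) :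
    (∀ m₁ m₂ : HeisenbergGroup n ⧸ Γ,
      HeisenbergGroup.IsBlockable Γ m₁ m₂ ↔ HeisenbergGroup.IsMidpointBlockable Γ m₁ m₂) ∧
    (∀ m : HeisenbergGroup n ⧸ Γ, HeisenbergGroup.IsBlockable Γ m m) ∧
    (Dense {p : (HeisenbergGroup n ⧸ Γ) × (HeisenbergGroup n ⧸ Γ) |
        HeisenbergGroup.IsBlockable Γ p.1 p.2} ∧
      ∃ (S : ℕ → Set ((HeisenbergGroup n ⧸ Γ) × (HeisenbergGroup n ⧸ Γ))) (k : ℕ → ℕ),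
        (∀ i, 0 < k i ∧ HeisenbergGroup.IsClosedSubmanifold Γ (S i) (k i)) ∧
        {p : (HeisenbergGroup n ⧸ Γ) × (HeisenbergGroup n ⧸ Γ) |
          HeisenbergGroup.IsBlockable Γ p.1 p.2} = ⋃ i, S i) ∧
    (∀ μ : Measure (HeisenbergGroup n ⧸ Γ), IsProbabilityMeasure μ →
      SMulInvariantMeasure (HeisenbergGroup n) (HeisenbergGroup n ⧸ Γ) μ →
      ∀ᵐ p ∂(μ.prod μ), ¬ HeisenbergGroup.IsBlockable Γ p.1 p.2) := by
  have hspan := HeisenbergGroup.span_horizontalLattice Γ hΓ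
  have := HeisenbergGroup.discreteTopology_horizontalLattice Γ hΓ
  obtain ⟨R⟩ := HeisenbergGroup.nonempty_rationalCoordinates Γ hn hΓ
  refine ⟨R.isBlockable_iff_isMidpointBlockable hspan, fun m => ?_,
    ⟨R.dense_isBlockable hspan, R.exists_isBlockable_eq_iUnion hn hspan⟩,
    fun μ _ _ => R.ae_not_isBlockable hn hspan μ⟩
  rw [R.isBlockable_iff_torusProj hspan, sub_self]
  exact ⟨0, zero_mem _, rfl⟩
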